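/- For $1\le p<\infty$ let $X^p(\mathbb{R}_+)$ be the space of functions $f:\mathbb{R}_+\to\mathbb{C}$ such that $x\mapsto f(x)x^{-1/p}$ belongs to $L^p(\mathbb{R}_+)$, with norm $\|f\|_{X^p}=\|f(\cdot)(\cdot)^{-1/p}\|_{L^p(\mathbb{R}_+)}$. Let $\Theta=x\frac{d}{dx}$ be the infinitesimal generator of the group $U(t)f(x)=f(e^tx)$, $t\in\mathbb{R}$, on $X^p(\mathbb{R}_+)$ (derivative of $U(t)f$ at $t=0$ in the norm of $X^p$). Let $\mathbf{B}_\pi^p(\Theta)$ be the set of all $f\in X^p(\mathbb{R}_+)$ that belong to the domains of all powers $\Theta^k$ and satisfy $\|\Theta^kf\|_{X^p}\le\pi^k\|f\|_{X^p}$ for all $k\in\mathbb{N}$. **Theorem.** Let $\{t_k\}_{k\in\mathbb{Z}}$ be a sequence of real numbers with $\sup_{k\in\mathbb{Z}}|t_k-k|<1/4$, and put $$G(z)=(z-t_0)\prod_{k=1}^{\infty}\left(1-\frac{z}{t_k}\right)\left(1-\frac{z}{t_{-k}}\right),\qquad z\in\mathbb{C}.$$ The product (over $k\ge1$, with the factors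 paired as written) converges unconditionally and locally uniformly on $\mathbb{C}$, $G$ is entire, and $G'(t_k)\ne0$ for all $k\in\mathbb{Z}$. Moreover, let $1<p<\infty$, $1/p+1/q=1$, $f\in\mathbf{B}_\pi^p(\Theta)$, $g\in X^q(\mathbb{R}_+)$, and define, for $t\in\mathbb{R}$, $$\Phi(t)=\int_{\mathbb{R}_+}f(e^tx)g(x)\frac{dx}{x},\qquad \Psi(t)=\int_{\mathbb{R}_+}\frac{f(e^tx)-f(x)}{t}\,g(x)\frac{dx}{x}\ \ (t\ne0),\qquad \Psi(0)=\int_{\mathbb{R}_+}\Theta f(x)\,g(x)\frac{dx}{x}.$$ All these integrals converge absolutely, and $$\Psi(t)=\sum_{k\in\mathbb{Z}}\Psi(t_k)\frac{G(t)}{G'(t_k)(t-t_k)},$$ where the series converges unconditionally and uniformly on every compact subset of $\mathbb{R}$ (the quotient $\frac{G(t)}{G'(t_k)(t-t_k)}$ is read as its limit $1$ at $t=t_k$). Consequently, in the same sense, $$\Phi(t)-\Phi(0)=\sum_{k\in\mathbb{Z}}t\,\Psi(t_k)\frac{G(t)}{G'(t_k)(t-t_k)}.$$ -/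

import Mathlib

open MeasureTheory Filter Topology Set

noncomputable section

/-- The norm of the Mellin-Lebesgue space `X^p(ℝ₊)`, `1 ≤ p < ∞`: the `L^p(0,∞)` norm of
`x ↦ f(x) x^{-1/p}`. Functions on `ℝ₊` are represented by functions on `ℝ`, of which only the values
on `(0,∞)` matter. -/
def mellinXNorm (p : ℝ) (f : ℝ → ℂ) : ENNReal :=
  eLpNorm (fun x : ℝ => f x * ((x ^ (-1 / p) : ℝ) : ℂ)) (ENNReal.ofReal p)
    (volume.restrict (Ioi (0 : ℝ)))

/-- Membership in `X^p(ℝ₊)`: `f(x) x^{-1/p}` is in `L^p(0,∞)`. -/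
def MemMellinX (p : ℝ) (f : ℝ → ℂ) : Prop :=
  MemLp (fun x : ℝ => f x * ((x ^ (-1 / p) : ℝ) : ℂ)) (ENNReal.ofReal p)
    (volume.restrict (Ioi (0 : ℝ)))

/-- The Mellin translations `(U(s) f)(x) = f(e^s x)`. -/
def mellinTranslate (s : ℝ) (f : ℝ → ℂ) : ℝ → ℂ := fun x => f (Real.exp s * x)

/-- `f` is in the domain of the infinitesimal generator `Θ = x d/dx` of the group `U` on `X^p(ℝ₊)`
and `Θ f = h` (almost everywhere): the quotients `(U(s) f - f) / s` converge to `h` in `X^p(ℝ₊)`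
as `s → 0`. -/
def IsMellinTheta (p : ℝ) (f h : ℝ → ℂ) : Prop :=
  MemMellinX p f ∧ MemMellinX p h ∧
    Tendsto (fun s : ℝ => mellinXNorm p (fun x => (mellinTranslate s f x - f x) / (s : ℂ) - h x))
      (𝓝[≠] 0) (𝓝 0)

open Classical in
/-- The generator `Θ` on `X^p(ℝ₊)`: a representative of `Θ f` (unique up to null sets) if `f` is in
the domain, and zero otherwise. -/
def mellinTheta (p : ℝ) (f : ℝ → ℂ) : ℝ → ℂ :=
  if hf : ∃ h, IsMellinTheta p f h then hf.choose else 0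

/-- The domain `D^k(Θ)` of the power `Θ^k` in `X^p(ℝ₊)`. -/
def MemMellinDomain (p : ℝ) (k : ℕ) (f : ℝ → ℂ) : Prop :=
  MemMellinX p f ∧ ∀ j < k, ∃ h, IsMellinTheta p ((mellinTheta p)^[j] f) h

/-- The Bernstein space `B_σ^p(Θ)`: all `f ∈ D^∞(Θ)` with `‖Θ^k f‖ ≤ σ^k ‖f‖` in `X^p(ℝ₊)` for
all `k`. -/
def MemMellinBernstein (p σ : ℝ) (f : ℝ → ℂ) : Prop :=
  (∀ k : ℕ, MemMellinDomain p k f) ∧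
    ∀ k : ℕ, mellinXNorm p ((mellinTheta p)^[k] f) ≤ ENNReal.ofReal (σ ^ k) * mellinXNorm p f

/-- The pairing `Φ(s) = ∫_{ℝ₊} f(e^s x) g(x) dx/x`. -/
def mellinPhi (f g : ℝ → ℂ) (s : ℝ) : ℂ :=
  ∫ x in Ioi (0 : ℝ), mellinTranslate s f x * g x / (x : ℂ)

/-- The function `Ψ(s) = ∫_{ℝ₊} ((f(e^s x) - f(x)) / s) g(x) dx/x` for `s ≠ 0`, and
`Ψ(0) = ∫_{ℝ₊} (Θ f)(x) g(x) dx/x`. -/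
def mellinPsi (p : ℝ) (f g : ℝ → ℂ) (s : ℝ) : ℂ :=
  if s = 0 then ∫ x in Ioi (0 : ℝ), mellinTheta p f x * g x / (x : ℂ)
  else ∫ x in Ioi (0 : ℝ), (mellinTranslate s f x - f x) / (s : ℂ) * g x / (x : ℂ)

/-- The factor `(1 - z / t_k) (1 - z / t_{-k})`, with `k = n + 1 ≥ 1`, of the canonical product. -/
def samplingFactor (t : ℤ → ℝ) (n : ℕ) (z : ℂ) : ℂ :=
  (1 - z / (t ((n : ℤ) + 1) : ℂ)) * (1 - z / (t (-((n : ℤ) + 1)) : ℂ))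

/-- The canonical product `G(z) = (z - t_0) ∏_{k ≥ 1} (1 - z / t_k) (1 - z / t_{-k})`. -/
def samplingG (t : ℤ → ℝ) (z : ℂ) : ℂ :=
  (z - (t 0 : ℂ)) * ∏' n : ℕ, samplingFactor t n z

/-- The function `s ↦ G(s) / (G'(t_k) (s - t_k))` on `ℝ`, with the value `1` at the removable
singularity `s = t_k`. -/
def samplingKernel (t : ℤ → ℝ) (k : ℤ) (s : ℝ) : ℂ :=
  if s = t k then 1
  else samplingG t (s : ℂ) / (deriv (samplingG t) (t k : ℂ) * ((s : ℂ) - (t k : ℂ)))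

end

/-! ### Elementary inequalities for the factors of the canonical product -/

/-! The proof rests on a lower bound for G by comparison with the sine. Put L = sup |t_k - k|.
`samplingG_ge` says that |G(z)| is at least c |z - t_m| e^{π|Im z|} (1 + |z|)^{-4L} / (1 + |z - m|),
where m is an integer nearest to Re z. The k-th pair of factors of G is at least e^{-ℓ_k} times the
factor 1 - z²/k² of Euler's product, the pair with a zero close to z being treated separately; ℓ_k
is L times a harmonic-type term plus a summable remainder. With N = ⌊|z|⌋ the harmonic terms sum to
4 log(N + 1) + O(1): three logarithms from k < N and one from k > N + 1. This is the origin of the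
exponent 4L, and L < 1/4 means 4L < 1.

Hence the zeros of G are exactly the t_k, they are simple, |G'(t_k)| is at least a multiple of (1 +
|k|)^{-4L}, and |G| is at least a multiple of e^{π|Im z|} R^{-4L} on the circles of radius R = N +
1/2.

On the function side, Mellin translations are isometries, so by Hölder's inequality the k-th
derivative of Φ, which is the pairing of Θ^k f with g, is bounded by π^k M on the whole line. Taylor
expansion extends Φ to an entire E with |E(z)| ≤ M e^{π|Im z|}, and Ψ extends to P(z) = (E(z) -
E(0))/z (`MemMellinBernstein.exists_entire_mellinPsi`).

Partial fractions of P/G in the disc of radius R leave as remainder the integral of P(z)/((z - s)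
G(z)) over the circle, which is O(R^{4L-1}) (`tendsto_symmetric_sum`). The terms of the series are
O(|k|^{4L-2}), uniformly for s in a compact set, so convergence is absolute and uniform
(`exists_summable_bound`). Both estimates use the decay 1/|z| that P has and E lacks; this is why
the series is written for Ψ and only afterwards multiplied by s. -/

/-- For x ≤ 1/2, -log(1 - x) ≤ x/(1 - x) ≤ x + 2x². For larger x the bound 1 - x degenerates, and
the floor 4/25 = (2/5)² takes over because e^{-2} ≤ 4/25. -/
lemma exp_neg_le_of_one_sub_le {x y ρ : ℝ} (hx : 0 ≤ x) (h1 : 1 - x ≤ ρ) (h2 : 4 / 25 ≤ ρ)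
    (hy : x + 8 * x ^ 2 ≤ y) : Real.exp (-y) ≤ ρ := by
  refine (Real.exp_le_exp.2 (neg_le_neg hy)).trans ?_
  rcases le_or_gt x (1 / 2) with hx2 | hx2
  · refine le_trans ?_ h1
    have hpos : 0 < 1 - x := by linarith
    rw [← Real.le_log_iff_exp_le hpos]
    refine le_trans ?_ (Real.one_sub_inv_le_log_of_pos hpos)
    have h3 : (1 - x)⁻¹ = 1 + x + x ^ 2 * (1 - x)⁻¹ := by field_simp; ring
    have h4 : (1 - x)⁻¹ ≤ 2 := by
      rw [inv_le_comm₀ hpos (by norm_num)]; linarith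
    nlinarith [sq_nonneg x]
  · refine le_trans ?_ h2
    have h3 : Real.exp (-(x + 8 * x ^ 2)) ≤ Real.exp (-2) := by
      apply Real.exp_le_exp.2; nlinarith
    refine h3.trans ?_
    have h4 : (5 / 2 : ℝ) ≤ Real.exp 1 := by linarith [Real.exp_one_gt_d9]
    have h5 : Real.exp (-2) * (Real.exp 1 * Real.exp 1) = 1 := by
      rw [← Real.exp_add, ← Real.exp_add]; norm_num
    nlinarith [Real.exp_pos (-2), mul_le_mul h4 h4 (by norm_num) (Real.exp_pos 1).le]

/-- Let u, v be the two distances. The parallelogram law fixes u² + v², so (u + v)/(uv) decreases in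
uv = |k² - z²|, and the worst case is real z, where uv = |k² - |z|²| and equality holds. -/
lemma inv_norm_sub_add_inv_norm_add_le {k : ℝ} {z : ℂ} (hk : 0 < k) (hr : k ≠ ‖z‖) :
    1 / ‖(k : ℂ) - z‖ + 1 / ‖(k : ℂ) + z‖ ≤ 2 * max k ‖z‖ / |k ^ 2 - ‖z‖ ^ 2| := by
  set u := ‖(k : ℂ) - z‖
  set v := ‖(k : ℂ) + z‖
  set d := |k ^ 2 - ‖z‖ ^ 2| with hd
  have hknorm : ‖(k : ℂ)‖ = k := by simp [abs_of_pos hk]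
  have hu2 : u ^ 2 + v ^ 2 = 2 * (k ^ 2 + ‖z‖ ^ 2) := by
    have := parallelogram_law_with_norm ℝ (k : ℂ) z
    rw [hknorm] at this
    simp only [u, v]; nlinarith
  have huv : d ≤ u * v := by
    have h1 : u * v = ‖(k : ℂ) ^ 2 - z ^ 2‖ := by
      simp only [u, v, ← norm_mul]; congr 1; ring
    have h2 := abs_norm_sub_norm_le ((k : ℂ) ^ 2) (z ^ 2)
    rw [norm_pow, norm_pow, hknorm] at h2
    rw [h1]; exact h2
  have hdpos : 0 < d := by
    apply abs_pos.2
    intro h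
    have h' : k ^ 2 = ‖z‖ ^ 2 := by linarith
    exact hr ((sq_eq_sq₀ hk.le (norm_nonneg z)).1 h')
  have hu0 : 0 ≤ u := norm_nonneg _
  have hv0 : 0 ≤ v := norm_nonneg _
  have huvpos : 0 < u * v := hdpos.trans_le huv
  have hu : 0 < u := lt_of_le_of_ne hu0 (by rintro h; rw [← h] at huvpos; simp at huvpos)
  have hv : 0 < v := lt_of_le_of_ne hv0 (by rintro h; rw [← h] at huvpos; simp at huvpos)
  have hM : (2 * max k ‖z‖) ^ 2 = 2 * (k ^ 2 + ‖z‖ ^ 2) + 2 * d := by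
    rcases le_total k ‖z‖ with h | h
    · rw [max_eq_right h, hd, abs_of_nonpos (by nlinarith [norm_nonneg z])]; ring
    · rw [max_eq_left h, hd, abs_of_nonneg (by nlinarith [norm_nonneg z])]; ring
  have hM0 : 0 ≤ max k ‖z‖ := le_max_of_le_left hk.le
  rw [div_add_div _ _ hu.ne' hv.ne', div_le_div_iff₀ huvpos hdpos]
  refine le_of_sq_le_sq ?_ (by positivity)
  have e1 : ((1 * v + u * 1) * d) ^ 2 = (2 * (k ^ 2 + ‖z‖ ^ 2) + 2 * (u * v)) * d ^ 2 := by
    rw [← hu2]; ring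
  have e2 : (2 * max k ‖z‖ * (u * v)) ^ 2
      = (2 * (k ^ 2 + ‖z‖ ^ 2) + 2 * d) * (u * v) ^ 2 := by
    rw [← hM]; ring
  rw [e1, e2]
  have h3 : d ^ 2 ≤ (u * v) ^ 2 := by gcongr
  have h4 : (u * v) * d ^ 2 ≤ d * (u * v) ^ 2 := by
    nlinarith [mul_le_mul_of_nonneg_left huv (mul_pos hdpos huvpos).le]
  nlinarith [mul_le_mul_of_nonneg_left h3 (by positivity : 0 ≤ k ^ 2 + ‖z‖ ^ 2)]

section Factor

variable {L k τ : ℝ} {z : ℂ}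

lemma norm_one_sub_div_eq (hτ : 0 < τ) : ‖1 - z / (τ : ℂ)‖ = ‖(τ : ℂ) - z‖ / τ := by
  have : (τ : ℂ) ≠ 0 := by exact_mod_cast hτ.ne'
  rw [one_sub_div this, norm_div]; simp [abs_of_pos hτ]

lemma half_norm_sub_le (hL : L ≤ 1 / 4) (hτ : |τ - k| ≤ L) (hz : 1 / 2 ≤ ‖(k : ℂ) - z‖) :
    ‖(k : ℂ) - z‖ / 2 ≤ ‖(τ : ℂ) - z‖ := by
  have h1 : ‖(k : ℂ) - z‖ ≤ ‖(τ : ℂ) - z‖ + |τ - k| := by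
    have h2 : (k : ℂ) - z = ((τ : ℂ) - z) - ((τ - k : ℝ) : ℂ) := by push_cast; ring
    rw [h2]
    refine (norm_sub_le _ _).trans ?_
    simp only [Complex.norm_real, Real.norm_eq_abs, le_refl]
  linarith

/-- The constant is 1/2 · 4/5: moving k to τ at most halves the distance to z, and τ ≤ 5k/4. -/
lemma factor_ge_const (hL : L ≤ 1 / 4) (hk : 1 ≤ k) (hτ : |τ - k| ≤ L)
    (hz : 1 / 2 ≤ ‖(k : ℂ) - z‖) :
    2 / 5 * ‖1 - z / (k : ℂ)‖ ≤ ‖1 - z / (τ : ℂ)‖ := by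
  have h := abs_le.1 hτ
  have hτ0 : 0 < τ := by linarith
  rw [norm_one_sub_div_eq hτ0, norm_one_sub_div_eq (by linarith : 0 < k)]
  have h1 := half_norm_sub_le hL hτ hz
  rw [mul_div_assoc', div_le_div_iff₀ (by linarith) hτ0]
  nlinarith [norm_nonneg ((k : ℂ) - z)]

lemma factor_ge_one_sub (hL : L ≤ 1 / 4) (hk : 1 ≤ k) (hτ : |τ - k| ≤ L)
    (hz : 1 / 2 ≤ ‖(k : ℂ) - z‖) :
    ‖1 - z / (k : ℂ)‖ * (1 - L * ‖z‖ / (k - L) * (1 / ‖(k : ℂ) - z‖)) ≤ ‖1 - z / (τ : ℂ)‖ := by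
  have h := abs_le.1 hτ
  have hk0 : 0 < k := by linarith
  have hτ0 : 0 < τ := by linarith
  have hL0 : 0 ≤ L := (abs_nonneg _).trans hτ
  have hkc : (k : ℂ) ≠ 0 := by exact_mod_cast hk0.ne'
  have hτc : (τ : ℂ) ≠ 0 := by exact_mod_cast hτ0.ne'
  have h1 : (1 - z / (τ : ℂ)) = (1 - z / (k : ℂ)) - (-(z * ((τ - k : ℝ) : ℂ) / ((k : ℂ) * τ))) := by
    push_cast; field_simp; ring
  have h2 : ‖-(z * ((τ - k : ℝ) : ℂ) / ((k : ℂ) * τ))‖ ≤ ‖z‖ * L / (k * (k - L)) := by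
    rw [norm_neg, norm_div, norm_mul, norm_mul, Complex.norm_real, Complex.norm_real,
      Complex.norm_real, Real.norm_eq_abs, Real.norm_eq_abs, Real.norm_eq_abs, abs_of_pos hk0,
      abs_of_pos hτ0]
    have : 0 < k - L := by linarith
    gcongr
    linarith
  have h3 := norm_sub_norm_le (1 - z / (k : ℂ)) (-(z * ((τ - k : ℝ) : ℂ) / ((k : ℂ) * τ)))
  rw [← h1] at h3
  refine le_trans (le_of_eq ?_) ((sub_le_sub_left h2 _).trans h3)
  rw [norm_one_sub_div_eq hk0]
  have h4 : ‖(k : ℂ) - z‖ ≠ 0 := by linarith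
  have h5 : k - L ≠ 0 := by linarith
  field_simp

/-- The second factor becomes an instance of the first under z ↦ -z, σ ↦ -σ. Multiplying the two
relative bounds gives a ratio at least 1 - b, and at least (2/5)² in any case. -/
lemma pair_ge {σ b w : ℝ} (hL : L ≤ 1 / 4) (hk : 1 ≤ k) (hτ : |τ - k| ≤ L) (hσ : |σ - (-k)| ≤ L)
    (hz : 1 / 2 ≤ ‖(k : ℂ) - z‖) (hz' : 1 / 2 ≤ ‖(k : ℂ) + z‖)
    (hb : L * ‖z‖ / (k - L) * (1 / ‖(k : ℂ) - z‖ + 1 / ‖(k : ℂ) + z‖) ≤ b)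
    (hw : b + 8 * b ^ 2 ≤ w) :
    Real.exp (-w) * ‖1 - z ^ 2 / (k : ℂ) ^ 2‖
      ≤ ‖(1 - z / (τ : ℂ)) * (1 - z / (σ : ℂ))‖ := by
  have hσ' : |(-σ) - k| ≤ L := by rw [← abs_neg]; convert hσ using 2; ring
  have hz2 : 1 / 2 ≤ ‖(k : ℂ) - (-z)‖ := by rwa [sub_neg_eq_add]
  have hL0 : 0 ≤ L := (abs_nonneg _).trans hτ
  have e1 : 1 - z / (σ : ℂ) = 1 - (-z) / ((-σ : ℝ) : ℂ) := by push_cast; rw [neg_div_neg_eq]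
  have hkc : (k : ℂ) ≠ 0 := by exact_mod_cast (by linarith : k ≠ 0)
  have e2 : ‖1 - z ^ 2 / (k : ℂ) ^ 2‖ = ‖1 - z / (k : ℂ)‖ * ‖1 - (-z) / (k : ℂ)‖ := by
    rw [← norm_mul]; congr 1; field_simp; ring
  have c1 := factor_ge_const hL hk hτ hz
  have c2 := factor_ge_const hL hk hσ' hz2
  have d1 := factor_ge_one_sub hL hk hτ hz
  have d2 := factor_ge_one_sub hL hk hσ' hz2
  rw [e1, e2, norm_mul]
  rw [norm_neg, sub_neg_eq_add] at d2
  set A := ‖1 - z / (k : ℂ)‖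
  set B := ‖1 - (-z) / (k : ℂ)‖
  set A' := ‖1 - z / (τ : ℂ)‖
  set B' := ‖1 - (-z) / ((-σ : ℝ) : ℂ)‖
  have hkL : 0 < k - L := by linarith
  have ha0 : 0 ≤ L * ‖z‖ / (k - L) * (1 / ‖(k : ℂ) - z‖) := by positivity
  have hb0 : 0 ≤ L * ‖z‖ / (k - L) * (1 / ‖(k : ℂ) + z‖) := by positivity
  have hA : 0 < A := by
    simp only [A]; rw [norm_one_sub_div_eq (by linarith)]
    exact div_pos (by linarith) (by linarith)
  have hB : 0 < B := by
    simp only [B]; rw [norm_one_sub_div_eq (by linarith)]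
    exact div_pos (by linarith) (by linarith)
  rw [mul_add] at hb
  set a := L * ‖z‖ / (k - L) * (1 / ‖(k : ℂ) - z‖)
  set a' := L * ‖z‖ / (k - L) * (1 / ‖(k : ℂ) + z‖)
  rw [← le_div_iff₀ (mul_pos hA hB), mul_div_mul_comm]
  have f1 : 2 / 5 ≤ A' / A := by rw [le_div_iff₀ hA]; exact c1
  have f2 : 2 / 5 ≤ B' / B := by rw [le_div_iff₀ hB]; exact c2
  have g1 : 1 - a ≤ A' / A := by rw [le_div_iff₀ hA, mul_comm]; exact d1
  have g2 : 1 - a' ≤ B' / B := by rw [le_div_iff₀ hB, mul_comm]; exact d2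
  refine exp_neg_le_of_one_sub_le (x := b) (by linarith) ?_ (by nlinarith) hw
  -- If a, a' ≤ 1, then (1 - a)(1 - a') ≥ 1 - a - a'; otherwise 1 - b is negative and nothing is
  -- needed.
  rcases le_or_gt a 1 with h | h
  · rcases le_or_gt a' 1 with h' | h'
    · nlinarith [mul_le_mul g1 g2 (by linarith) (by linarith)]
    · nlinarith
  · nlinarith

end Factor

/-! ### Bounds for the logarithmic loss in the `k`-th pair of factors -/

/-- The main term of the loss, to be multiplied by `sup |t_k - k|`. -/
noncomputable def lossMain (N k : ℕ) : ℝ :=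
  if k < N then 2 / k + 1 / ((N : ℝ) - k)
  else if N + 2 ≤ k then 1 / ((k : ℝ) - N - 1) - 1 / ((k : ℝ) + N + 1) else 0

/-- The summable remainder of the loss. -/
noncomputable def lossRest (N k : ℕ) : ℝ :=
  if k < N then 1 / (k : ℝ) ^ 2 + 1 / ((N : ℝ) - k) ^ 2
  else if N + 2 ≤ k then 1 / (k : ℝ) ^ 2 + 1 / ((k : ℝ) - N - 1) ^ 2 else 1

lemma lossMain_nonneg (N k : ℕ) : 0 ≤ lossMain N k := by
  unfold lossMain
  split_ifs with h1 h2
  · have : (k : ℝ) < N := by exact_mod_cast h1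
    have : 0 < (N : ℝ) - k := by linarith
    positivity
  · have h3 : (N : ℝ) + 2 ≤ k := by exact_mod_cast h2
    rw [sub_nonneg]
    apply one_div_le_one_div_of_le <;> linarith [(Nat.cast_nonneg N : (0 : ℝ) ≤ N)]
  · rfl

lemma lossRest_nonneg (N k : ℕ) : 0 ≤ lossRest N k := by
  unfold lossRest
  split_ifs <;> positivity

/-- The coefficient of b must stay exactly L, since it becomes the exponent 4L. Replacing k/(k - L)
by 1 costs at most b/(12k), and this together with the quadratic term is absorbed in the summable
remainder. -/
lemma loss_aux {L k j b s : ℝ} (hL0 : 0 ≤ L) (hL : L ≤ 1 / 4) (hk : 1 ≤ k) (hj : 0 < j)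
    (hb0 : 0 ≤ b) (hb : b ≤ 2 / k + 1 / j) (hs : s ≤ k * b) :
    let x := L * b * (k / (k - L))
    L / (k - L) * s ≤ x ∧
      x + 8 * x ^ 2 ≤ L * b + 8 * (1 / k ^ 2 + 1 / j ^ 2) := by
  intro x
  have hkL : 0 < k - L := by linarith
  constructor
  · simp only [x]
    calc L / (k - L) * s ≤ L / (k - L) * (k * b) := by gcongr
      _ = _ := by ring
  have h1 : k / (k - L) ≤ 1 + (1 / 3) * (1 / k) := by
    rw [div_le_iff₀ hkL]
    have : (1 + 1 / 3 * (1 / k)) * (k - L) = k + 1 / 3 - L - (1 / 3) * (L / k) := by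
      field_simp; ring
    rw [this]
    have : L / k ≤ 1 / 4 := by rw [div_le_iff₀ (by linarith)]; linarith
    linarith
  set u := 1 / k with hu
  have hu0 : 0 ≤ u := by positivity
  have hu1 : u ≤ 1 := by rw [hu, div_le_one (by linarith)]; exact hk
  set v := 1 / j with hv
  have hv0 : 0 ≤ v := by positivity
  have hb' : b ≤ 2 * u + v := by rw [hu]; convert hb using 2; ring
  have hx0 : 0 ≤ x := by simp only [x]; positivity
  have hLb : 0 ≤ L * b := by positivity
  have hLb2 : L * b ≤ b / 4 := by nlinarith
  have hx1 : x ≤ L * b * (1 + 1 / 3 * u) := by simp only [x]; gcongr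
  have hx3 : x ≤ L * b + b * u / 12 := by nlinarith
  have hx4 : x ≤ b / 3 := by nlinarith
  have hx5 : x ^ 2 ≤ (b / 3) ^ 2 := by gcongr
  have hb2 : b ^ 2 ≤ (2 * u + v) ^ 2 := by gcongr
  have e1 : 1 / k ^ 2 = u ^ 2 := by rw [hu]; ring
  have e2 : 1 / j ^ 2 = v ^ 2 := by rw [hv]; ring
  rw [e1, e2]
  nlinarith [sq_nonneg (2 * u - v), sq_nonneg (b - u)]

lemma pair_ge_exp_loss {L τ σ : ℝ} {z : ℂ} {k : ℕ} (hL0 : 0 ≤ L) (hL : L ≤ 1 / 4) (hk : 1 ≤ k)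
    (hτ : |τ - k| ≤ L) (hσ : |σ - (-k)| ≤ L)
    (hz : 1 / 2 ≤ ‖(k : ℂ) - z‖) (hz' : 1 / 2 ≤ ‖(k : ℂ) + z‖) :
    Real.exp (-(L * lossMain ⌊‖z‖⌋₊ k + 8 * lossRest ⌊‖z‖⌋₊ k)) * ‖1 - z ^ 2 / (k : ℂ) ^ 2‖
      ≤ ‖(1 - z / (τ : ℂ)) * (1 - z / (σ : ℂ))‖ := by
  set N := ⌊‖z‖⌋₊ with hN
  have hk1 : (1 : ℝ) ≤ k := by exact_mod_cast hk
  have hNr : (N : ℝ) ≤ ‖z‖ := Nat.floor_le (norm_nonneg z)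
  have hrN : ‖z‖ < N + 1 := Nat.lt_floor_add_one _
  have hr0 := norm_nonneg z
  have hN0 : (0 : ℝ) ≤ N := Nat.cast_nonneg N
  by_cases h1 : k < N
  · have h1' : (k : ℝ) + 1 ≤ N := by exact_mod_cast h1
    have hj : 0 < (N : ℝ) - k := by linarith
    have eM : lossMain N k = 2 / k + 1 / ((N : ℝ) - k) := if_pos h1
    have eR : lossRest N k = 1 / (k : ℝ) ^ 2 + 1 / ((N : ℝ) - k) ^ 2 := if_pos h1
    have hs : ‖z‖ * (1 / ‖(k : ℂ) - z‖ + 1 / ‖(k : ℂ) + z‖) ≤ k * lossMain N k := by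
      have h2 := inv_norm_sub_add_inv_norm_add_le (k := (k : ℝ)) (z := z) (by linarith)
        (by intro h; linarith)
      refine (mul_le_mul_of_nonneg_left h2 hr0).trans ?_
      rw [max_eq_right (by linarith), abs_of_nonpos (by nlinarith), eM]
      have e3 : (k : ℝ) * (2 / k + 1 / ((N : ℝ) - k)) = 2 + k / ((N : ℝ) - k) := by
        field_simp
      have hd : 0 < -((k : ℝ) ^ 2 - ‖z‖ ^ 2) := by nlinarith
      have e4 : ‖z‖ * (2 * ‖z‖ / -((k : ℝ) ^ 2 - ‖z‖ ^ 2))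
          = 2 + 2 * (k : ℝ) ^ 2 / -((k : ℝ) ^ 2 - ‖z‖ ^ 2) := by
        rw [mul_div_assoc', div_eq_iff hd.ne', add_mul, div_mul_cancel₀ _ hd.ne']; ring
      rw [e3, e4]
      refine add_le_add le_rfl ?_
      rw [div_le_div_iff₀ hd hj]
      -- Here |z|² - k² ≥ (N - k)(N + k) ≥ 2k(N - k).
      have h5 : ((N : ℝ) - k) * (2 * k) ≤ -((k : ℝ) ^ 2 - ‖z‖ ^ 2) := by nlinarith
      nlinarith
    obtain ⟨q1, q2⟩ := loss_aux hL0 hL hk1 hj (lossMain_nonneg N k) eM.le hs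
    refine pair_ge hL hk1 hτ hσ (by exact_mod_cast hz) (by exact_mod_cast hz') ?_
      (q2.trans_eq (by rw [eR]))
    convert q1 using 1
    push_cast; ring
  · by_cases h2 : N + 2 ≤ k
    · have h2' : (N : ℝ) + 2 ≤ k := by exact_mod_cast h2
      have hj : 0 < (k : ℝ) - N - 1 := by linarith
      have eM : lossMain N k = 1 / ((k : ℝ) - N - 1) - 1 / ((k : ℝ) + N + 1) := by
        unfold lossMain; rw [if_neg h1, if_pos h2]
      have eR : lossRest N k = 1 / (k : ℝ) ^ 2 + 1 / ((k : ℝ) - N - 1) ^ 2 := by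
        unfold lossRest; rw [if_neg h1, if_pos h2]
      have hs : ‖z‖ * (1 / ‖(k : ℂ) - z‖ + 1 / ‖(k : ℂ) + z‖) ≤ k * lossMain N k := by
        have h3 := inv_norm_sub_add_inv_norm_add_le (k := (k : ℝ)) (z := z) (by linarith)
          (by intro h; linarith)
        refine (mul_le_mul_of_nonneg_left h3 hr0).trans ?_
        rw [max_eq_left (by linarith), abs_of_nonneg (by nlinarith), eM]
        have hd1 : 0 < (k : ℝ) - ‖z‖ := by linarith
        have hd2 : 0 < (k : ℝ) + ‖z‖ := by linarith
        have e4 : ‖z‖ * (2 * (k : ℝ) / ((k : ℝ) ^ 2 - ‖z‖ ^ 2))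
            = k * (1 / ((k : ℝ) - ‖z‖) - 1 / ((k : ℝ) + ‖z‖)) := by
          have : (k : ℝ) ^ 2 - ‖z‖ ^ 2 = (k - ‖z‖) * (k + ‖z‖) := by ring
          rw [this]; field_simp; ring
        rw [e4]
        have h5 : 1 / ((k : ℝ) - ‖z‖) ≤ 1 / ((k : ℝ) - N - 1) :=
          one_div_le_one_div_of_le hj (by linarith)
        have h6 : 1 / ((k : ℝ) + N + 1) ≤ 1 / ((k : ℝ) + ‖z‖) :=
          one_div_le_one_div_of_le hd2 (by linarith)
        gcongr
      have hbb : lossMain N k ≤ 2 / k + 1 / ((k : ℝ) - N - 1) := by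
        rw [eM]
        have : 0 ≤ 1 / ((k : ℝ) + N + 1) := by positivity
        have : 0 ≤ 2 / (k : ℝ) := by positivity
        linarith
      obtain ⟨q1, q2⟩ := loss_aux hL0 hL hk1 hj (lossMain_nonneg N k) hbb hs
      refine pair_ge hL hk1 hτ hσ (by exact_mod_cast hz) (by exact_mod_cast hz') ?_
        (q2.trans_eq (by rw [eR]))
      convert q1 using 1
      push_cast; ring
    -- For k = N or N + 1 the difference k - |z| may vanish, so only the constant bound 4/25 ≥
    -- e^{-8} is available.
    · have eM : lossMain N k = 0 := by unfold lossMain; rw [if_neg h1, if_neg h2]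
      have eR : lossRest N k = 1 := by unfold lossRest; rw [if_neg h1, if_neg h2]
      have hσ' : |(-σ) - k| ≤ L := by rw [← abs_neg]; convert hσ using 2; ring
      have c1 := factor_ge_const hL hk1 hτ (z := z) (by exact_mod_cast hz)
      have c2 := factor_ge_const hL hk1 hσ' (z := -z) (by rw [sub_neg_eq_add]; exact_mod_cast hz')
      have e1 : 1 - z / (σ : ℂ) = 1 - (-z) / ((-σ : ℝ) : ℂ) := by push_cast; rw [neg_div_neg_eq]
      have hkc : (k : ℂ) ≠ 0 := by exact_mod_cast (by lia : k ≠ 0)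
      have e2 : ‖1 - z ^ 2 / (k : ℂ) ^ 2‖
          = ‖1 - z / ((k : ℝ) : ℂ)‖ * ‖1 - (-z) / ((k : ℝ) : ℂ)‖ := by
        rw [← norm_mul]; congr 1; push_cast; field_simp; ring
      rw [e1, e2, norm_mul, eM, eR]
      have h3 : Real.exp (-(L * 0 + 8 * 1)) ≤ 4 / 25 :=
        exp_neg_le_of_one_sub_le (x := 21 / 25) (by norm_num) (by norm_num) le_rfl (by norm_num)
      calc _ ≤ 4 / 25 * (‖1 - z / ((k : ℝ) : ℂ)‖ * ‖1 - (-z) / ((k : ℝ) : ℂ)‖) := by gcongr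
        _ = (2 / 5 * ‖1 - z / ((k : ℝ) : ℂ)‖) * (2 / 5 * ‖1 - (-z) / ((k : ℝ) : ℂ)‖) := by ring
        _ ≤ _ := by gcongr

/-! ### Summing the losses over all pairs. -/

lemma sum_sub_shift_le {a : ℕ → ℝ} (ha : ∀ j, 0 ≤ a j) (n M : ℕ) :
    ∑ j ∈ Finset.range n, (a j - a (M + j)) ≤ ∑ j ∈ Finset.range M, a j := by
  rw [Finset.sum_sub_distrib]
  have h1 : ∑ j ∈ Finset.range n, a j ≤ ∑ j ∈ Finset.range (M + n), a j :=
    Finset.sum_le_sum_of_subset_of_nonneg (Finset.range_mono (by lia)) fun i _ _ => ha i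
  rw [Finset.sum_range_add] at h1
  linarith

lemma sum_one_div_succ_le (n : ℕ) :
    ∑ j ∈ Finset.range n, 1 / ((j : ℝ) + 1) ≤ 1 + Real.log n := by
  have h := harmonic_le_one_add_log n
  rw [harmonic] at h
  push_cast at h
  simpa [one_div] using h

lemma sum_one_div_succ_sq_le (n : ℕ) :
    ∑ j ∈ Finset.range n, 1 / ((j : ℝ) + 1) ^ 2 ≤ 2 := by
  have key : ∀ n : ℕ, ∑ j ∈ Finset.range (n + 1), 1 / ((j : ℝ) + 1) ^ 2 ≤ 2 - 1 / ((n : ℝ) + 1) := by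
    intro n
    induction n with
    | zero => norm_num
    | succ n ih =>
      rw [Finset.sum_range_succ]
      have h1 : 1 / (((n + 1 : ℕ) : ℝ) + 1) ^ 2 ≤ 1 / ((n : ℝ) + 1) - 1 / (((n + 1 : ℕ) : ℝ) + 1) := by
        push_cast
        rw [div_sub_div _ _ (by positivity) (by positivity), div_le_div_iff₀ (by positivity)
          (by positivity)]
        nlinarith [(Nat.cast_nonneg n : (0 : ℝ) ≤ n)]
      linarith
  cases n with
  | zero => norm_num
  | succ n =>
    have : 0 ≤ 1 / ((n : ℝ) + 1) := by positivity
    linarith [key n]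

lemma sum_ite_add_le {g h e : ℕ → ℝ} (N n : ℕ) (hg : ∀ j, j + 1 < N → 0 ≤ g j)
    (hh : ∀ j, 0 ≤ h j) (he : ∀ j, 0 ≤ e j) :
    ∑ i ∈ Finset.range n, (if i + 1 < N then g i else if N + 2 ≤ i + 1 then h (i - (N + 1)) else e i)
      ≤ ∑ j ∈ Finset.range (N - 1), g j + ∑ j ∈ Finset.range n, h j
        + ∑ j ∈ Finset.Ico (N - 1) (N + 1), e j := by
  -- Enlarging the range to N + 1 + n gives the far block exactly n terms. For N = 0 the truncated N
  -- - 1 leaves the single middle index 0.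
  have h1 : ∑ i ∈ Finset.range n,
      (if i + 1 < N then g i else if N + 2 ≤ i + 1 then h (i - (N + 1)) else e i)
      ≤ ∑ i ∈ Finset.range (N + 1 + n),
      (if i + 1 < N then g i else if N + 2 ≤ i + 1 then h (i - (N + 1)) else e i) := by
    refine Finset.sum_le_sum_of_subset_of_nonneg (Finset.range_mono (by lia)) fun i _ _ => ?_
    split_ifs with h1 h2
    · exact hg i h1
    · exact hh _
    · exact he i
  refine h1.trans (le_of_eq ?_)
  rw [Finset.sum_range_add, ← Finset.sum_range_add_sum_Ico _ (by lia : N - 1 ≤ N + 1)]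
  have e1 : ∑ i ∈ Finset.range (N - 1),
      (if i + 1 < N then g i else if N + 2 ≤ i + 1 then h (i - (N + 1)) else e i)
      = ∑ i ∈ Finset.range (N - 1), g i := by
    refine Finset.sum_congr rfl fun i hi => ?_
    rw [Finset.mem_range] at hi
    rw [if_pos (by lia)]
  have e2 : ∑ i ∈ Finset.Ico (N - 1) (N + 1),
      (if i + 1 < N then g i else if N + 2 ≤ i + 1 then h (i - (N + 1)) else e i)
      = ∑ i ∈ Finset.Ico (N - 1) (N + 1), e i := by
    refine Finset.sum_congr rfl fun i hi => ?_
    rw [Finset.mem_Ico] at hi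
    rw [if_neg (by lia), if_neg (by lia)]
  rw [e1, e2]
  have e3 : ∑ j ∈ Finset.range n, (if N + 1 + j + 1 < N then g (N + 1 + j) else
      if N + 2 ≤ N + 1 + j + 1 then h (N + 1 + j - (N + 1)) else e (N + 1 + j))
      = ∑ j ∈ Finset.range n, h j := by
    refine Finset.sum_congr rfl fun i hi => ?_
    rw [if_neg (by lia), if_pos (by lia)]
    congr 1; lia
  rw [e3]
  ring

lemma sum_reflect_succ (N : ℕ) (a : ℝ → ℝ) :
    ∑ j ∈ Finset.range (N - 1), a ((N : ℝ) - ((j : ℝ) + 1))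
      = ∑ j ∈ Finset.range (N - 1), a ((j : ℝ) + 1) := by
  rw [← Finset.sum_range_reflect]
  refine Finset.sum_congr rfl fun j hj => ?_
  rw [Finset.mem_range] at hj
  congr 1
  rw [Nat.cast_sub (by lia), Nat.cast_sub (by lia), Nat.cast_sub (by lia)]
  push_cast; ring

/-- The near block contributes 2H + H with H the harmonic number of N - 1, by reflection k ↦ N - k.
The far block is a difference of harmonic sums shifted by 2N + 2, hence at most the harmonic number
of 2N + 2. This makes 3 + 1 = 4 logarithms. -/
lemma sum_lossMain_le (N n : ℕ) :
    ∑ i ∈ Finset.range n, lossMain N (i + 1) ≤ 4 * Real.log (N + 1) + 6 := by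
  have h0 : ∀ i, lossMain N (i + 1) = if i + 1 < N then
      (fun i : ℕ => 2 * (1 / ((i : ℝ) + 1)) + 1 / ((N : ℝ) - ((i : ℝ) + 1))) i else
      if N + 2 ≤ i + 1 then (fun j : ℕ => (fun j : ℕ => 1 / ((j : ℝ) + 1)) j
        - (fun j : ℕ => 1 / ((j : ℝ) + 1)) ((2 * N + 2) + j)) (i - (N + 1))
      else (fun _ => (0 : ℝ)) i := by
    intro i
    unfold lossMain
    push_cast
    split_ifs with h1 h2
    · ring
    · have : (((i - (N + 1) : ℕ)) : ℝ) = i - (N + 1) := by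
        rw [Nat.cast_sub (by lia)]; push_cast; ring
      simp only [this]
      congr 2 <;> ring
    · rfl
  rw [Finset.sum_congr rfl fun i _ => h0 i]
  refine (sum_ite_add_le (g := fun i : ℕ => 2 * (1 / ((i : ℝ) + 1)) + 1 / ((N : ℝ) - ((i : ℝ) + 1)))
    (h := fun j : ℕ => (fun j : ℕ => 1 / ((j : ℝ) + 1)) j
        - (fun j : ℕ => 1 / ((j : ℝ) + 1)) ((2 * N + 2) + j)) (e := fun _ => (0 : ℝ))
    N n ?_ ?_ ?_).trans ?_
  · intro j hj
    have : (j : ℝ) + 1 < N := by exact_mod_cast hj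
    have : 0 < (N : ℝ) - ((j : ℝ) + 1) := by linarith
    positivity
  · intro j
    simp only
    rw [sub_nonneg]
    apply one_div_le_one_div_of_le (by positivity)
    push_cast; linarith [(Nat.cast_nonneg N : (0 : ℝ) ≤ N)]
  · intro j; exact le_rfl
  have hs := sum_sub_shift_le (a := fun j : ℕ => 1 / ((j : ℝ) + 1)) (fun j => by positivity) n
    (2 * N + 2)
  have hs2 := sum_one_div_succ_le (2 * N + 2)
  have hs3 := sum_one_div_succ_le (N - 1)
  rw [Finset.sum_add_distrib, ← Finset.mul_sum, sum_reflect_succ N (fun x => 1 / x)]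
  have hlog1 : Real.log ((N - 1 : ℕ) : ℝ) ≤ Real.log (N + 1) := by
    rcases Nat.eq_zero_or_pos (N - 1) with h | h
    · rw [h]; simp only [Nat.cast_zero, Real.log_zero]
      exact Real.log_nonneg (by linarith [(Nat.cast_nonneg N : (0 : ℝ) ≤ N)])
    · apply Real.log_le_log (by exact_mod_cast h)
      have : ((N - 1 : ℕ) : ℝ) ≤ (N : ℝ) := by exact_mod_cast Nat.sub_le N 1
      linarith
  have hlog2 : Real.log ((2 * N + 2 : ℕ) : ℝ) ≤ 1 + Real.log (N + 1) := by
    have : ((2 * N + 2 : ℕ) : ℝ) = 2 * ((N : ℝ) + 1) := by push_cast; ring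
    rw [this, Real.log_mul (by norm_num) (by positivity)]
    linarith [Real.log_two_lt_d9]
  simp only [Finset.sum_const_zero] at *
  linarith

lemma sum_lossRest_le (N n : ℕ) :
    ∑ i ∈ Finset.range n, lossRest N (i + 1) ≤ 10 := by
  have h0 : ∀ i, lossRest N (i + 1) ≤ 1 / ((i : ℝ) + 1) ^ 2 + if i + 1 < N then
      (fun i : ℕ => 1 / ((N : ℝ) - ((i : ℝ) + 1)) ^ 2) i else
      if N + 2 ≤ i + 1 then (fun j : ℕ => 1 / ((j : ℝ) + 1) ^ 2) (i - (N + 1))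
      else (fun _ => (1 : ℝ)) i := by
    intro i
    unfold lossRest
    push_cast
    split_ifs with h1 h2
    · exact le_rfl
    · have : (((i - (N + 1) : ℕ)) : ℝ) = i - (N + 1) := by
        rw [Nat.cast_sub (by lia)]; push_cast; ring
      simp only [this]
      apply le_of_eq
      congr 3; ring
    · have : 0 ≤ 1 / ((i : ℝ) + 1) ^ 2 := by positivity
      linarith
  refine (Finset.sum_le_sum fun i _ => h0 i).trans ?_
  rw [Finset.sum_add_distrib]
  have h1 := sum_ite_add_le (g := fun i : ℕ => 1 / ((N : ℝ) - ((i : ℝ) + 1)) ^ 2)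
    (h := fun j : ℕ => 1 / ((j : ℝ) + 1) ^ 2) (e := fun _ => (1 : ℝ)) N n
    (fun j _ => by positivity) (fun j => by positivity) (fun j => zero_le_one)
  rw [sum_reflect_succ N (fun x => 1 / x ^ 2)] at h1
  have h2 := sum_one_div_succ_sq_le n
  have h3 := sum_one_div_succ_sq_le (N - 1)
  have h4 : ∑ j ∈ Finset.Ico (N - 1) (N + 1), (1 : ℝ) ≤ 2 := by
    rw [Finset.sum_const, Nat.card_Ico, nsmul_eq_mul, mul_one]
    have : N + 1 - (N - 1) ≤ 2 := by lia
    exact_mod_cast this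
  linarith

/-! ### The canonical product -/

/-- The pair for which z may be close to k or τ: the factors |z - τ| and |z - k| are
cross-multiplied instead of compared, so either may vanish. What remains is 1/τ ≥ (4/5)/k and the
opposite factor, which loses 2/5. -/
lemma pole_pair_ge {L k τ σ : ℝ} {z : ℂ} (hL : L ≤ 1 / 4) (hk : 1 ≤ k) (hτ : |τ - k| ≤ L)
    (hσ : |σ - (-k)| ≤ L) (hz' : 1 / 2 ≤ ‖(k : ℂ) + z‖) :
    8 / 25 * ‖z - (τ : ℂ)‖ * ‖1 - z ^ 2 / (k : ℂ) ^ 2‖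
      ≤ ‖z - (k : ℂ)‖ * ‖(1 - z / (τ : ℂ)) * (1 - z / (σ : ℂ))‖ := by
  have hσ' : |(-σ) - k| ≤ L := by rw [← abs_neg]; convert hσ using 2; ring
  have h := abs_le.1 hτ
  have hτ0 : 0 < τ := by linarith
  have hk0 : 0 < k := by linarith
  have c2 := factor_ge_const hL hk hσ' (z := -z) (by rwa [sub_neg_eq_add])
  have e1 : 1 - z / (σ : ℂ) = 1 - (-z) / ((-σ : ℝ) : ℂ) := by push_cast; rw [neg_div_neg_eq]
  have hkc : (k : ℂ) ≠ 0 := by exact_mod_cast hk0.ne'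
  have e2 : ‖1 - z ^ 2 / (k : ℂ) ^ 2‖ = ‖1 - z / (k : ℂ)‖ * ‖1 - (-z) / (k : ℂ)‖ := by
    rw [← norm_mul]; congr 1; field_simp; ring
  rw [e1, e2, norm_mul, norm_one_sub_div_eq hτ0, norm_one_sub_div_eq hk0, norm_sub_rev z,
    norm_sub_rev z]
  set A := ‖(τ : ℂ) - z‖
  set B := ‖(k : ℂ) - z‖
  have h45 : 4 / 5 * (1 / k) ≤ 1 / τ := by
    rw [mul_one_div, div_le_div_iff₀ hk0 hτ0]; linarith
  calc _ = A * B * (4 / 5 * (1 / k)) * (2 / 5 * ‖1 - -z / (k : ℂ)‖) := by ring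
    _ ≤ A * B * (1 / τ) * ‖1 - -z / ((-σ : ℝ) : ℂ)‖ := by gcongr
    _ = _ := by ring

section Product

variable {t : ℤ → ℝ} {L : ℝ}

/-- Pairing makes the product converge: the linear term is z(τ + σ)/(τσ) with τ + σ bounded and τσ
of order n², whereas single factors would only give 1/n. -/
lemma samplingFactor_sub_one_norm_le (hL : L ≤ 1 / 4) (ht : ∀ k, |t k - k| ≤ L)
    (n : ℕ) {z : ℂ} {B : ℝ} (hz : ‖z‖ ≤ B) :
    ‖samplingFactor t n z - 1‖ ≤ 2 * (B + B ^ 2) * (1 / ((n : ℝ) + 1) ^ 2) := by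
  unfold samplingFactor
  have h1 := ht ((n : ℤ) + 1)
  have h2 := ht (-((n : ℤ) + 1))
  push_cast at h1 h2
  set τ := t ((n : ℤ) + 1)
  set σ := t (-((n : ℤ) + 1))
  have hn : (0 : ℝ) ≤ n := Nat.cast_nonneg n
  have a1 := abs_le.1 h1
  have a2 := abs_le.1 h2
  have hτ : 0 < τ := by linarith
  have hσ : σ < 0 := by linarith
  have hτc : (τ : ℂ) ≠ 0 := by exact_mod_cast hτ.ne'
  have hσc : (σ : ℂ) ≠ 0 := by exact_mod_cast hσ.ne
  have hB : 0 ≤ B := (norm_nonneg z).trans hz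
  have e : (1 - z / (τ : ℂ)) * (1 - z / (σ : ℂ)) - 1
      = (-z * ((τ + σ : ℝ) : ℂ) + z ^ 2) / ((τ * σ : ℝ) : ℂ) := by
    push_cast; field_simp; ring
  rw [e, norm_div]
  have n1 : ‖-z * ((τ + σ : ℝ) : ℂ) + z ^ 2‖ ≤ B + B ^ 2 := by
    refine (norm_add_le _ _).trans ?_
    rw [norm_mul, norm_neg, norm_pow, Complex.norm_real, Real.norm_eq_abs]
    have : |τ + σ| ≤ 1 := abs_le.2 ⟨by linarith, by linarith⟩
    have := mul_le_mul hz this (abs_nonneg _) hB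
    have := pow_le_pow_left₀ (norm_nonneg z) hz 2
    linarith
  have n2 : ((n : ℝ) + 1) ^ 2 / 2 ≤ ‖((τ * σ : ℝ) : ℂ)‖ := by
    rw [Complex.norm_real, Real.norm_eq_abs, abs_mul, abs_of_pos hτ, abs_of_neg hσ]
    have b1 : 3 / 4 * ((n : ℝ) + 1) ≤ τ := by linarith
    have b2 : 3 / 4 * ((n : ℝ) + 1) ≤ -σ := by linarith
    nlinarith [mul_le_mul b1 b2 (by positivity) hτ.le]
  calc _ ≤ (B + B ^ 2) / (((n : ℝ) + 1) ^ 2 / 2) := by gcongr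
    _ = _ := by field_simp

lemma continuous_samplingFactor (t : ℤ → ℝ) (n : ℕ) : Continuous (samplingFactor t n) := by
  unfold samplingFactor; fun_prop

lemma hasProdLocallyUniformlyOn_samplingFactor (hL : L ≤ 1 / 4) (ht : ∀ k, |t k - k| ≤ L) :
    HasProdLocallyUniformlyOn (samplingFactor t) (fun z => ∏' n : ℕ, samplingFactor t n z)
      Set.univ := by
  apply hasProdLocallyUniformlyOn_of_forall_compact isOpen_univ
  intro K _ hK
  obtain ⟨B, hB⟩ := hK.isBounded.exists_norm_le
  have hs : Summable fun n : ℕ => 2 * (B + B ^ 2) * (1 / ((n : ℝ) + 1) ^ 2) := by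
    apply Summable.mul_left
    have := (summable_nat_add_iff 1).2 (Real.summable_one_div_nat_pow.2 (by norm_num : 1 < 2))
    simpa using this
  have h := Summable.hasProdUniformlyOn_nat_one_add (f := fun n z => samplingFactor t n z - 1) hK hs
    (Eventually.of_forall fun n z hz => samplingFactor_sub_one_norm_le hL ht n (hB z hz))
    (fun n => ((continuous_samplingFactor t n).sub continuous_const).continuousOn)
  simpa using! h

lemma tendsto_prod_samplingFactor (hL : L ≤ 1 / 4) (ht : ∀ k, |t k - k| ≤ L) (z : ℂ) :
    Tendsto (fun n => (z - (t 0 : ℂ)) * ∏ j ∈ Finset.range n, samplingFactor t j z) atTop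
      (𝓝 (samplingG t z)) :=
  ((hasProdLocallyUniformlyOn_samplingFactor hL ht).hasProd
    (Set.mem_univ z)).tendsto_prod_nat.const_mul _

lemma differentiable_samplingG (hL : L ≤ 1 / 4) (ht : ∀ k, |t k - k| ≤ L) :
    Differentiable ℂ (samplingG t) := by
  have h := (hasProdLocallyUniformlyOn_samplingFactor hL ht).differentiableOn
    (Eventually.of_forall fun s => ?_) isOpen_univ
  · have h' := differentiableOn_univ.1 h
    unfold samplingG
    exact (differentiable_id.sub_const _).mul h'
  · apply Differentiable.differentiableOn
    simp only [samplingFactor]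
    fun_prop

lemma samplingG_apply_node (hL : L ≤ 1 / 4) (ht : ∀ k, |t k - k| ≤ L) (m : ℤ) :
    samplingG t (t m : ℂ) = 0 := by
  unfold samplingG
  rcases lt_trichotomy m 0 with h | h | h
  · have e : -(((-m - 1).toNat : ℤ) + 1) = m := by lia
    have hm : (m : ℝ) ≤ -1 := by exact_mod_cast (by lia : m ≤ -1)
    have h1 := abs_le.1 (ht m)
    have h0 : (t m : ℂ) ≠ 0 := by exact_mod_cast (by linarith : t m < 0).ne
    rw [tprod_of_exists_eq_zero ⟨(-m - 1).toNat, by simp only [samplingFactor, e]; simp [h0]⟩,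
      mul_zero]
  · simp [h]
  · have e : (((m - 1).toNat : ℤ) + 1) = m := by lia
    have hm : (1 : ℝ) ≤ m := by exact_mod_cast h
    have h1 := abs_le.1 (ht m)
    have h0 : (t m : ℂ) ≠ 0 := by exact_mod_cast (by linarith : 0 < t m).ne'
    rw [tprod_of_exists_eq_zero ⟨(m - 1).toNat, by simp only [samplingFactor, e]; simp [h0]⟩,
      mul_zero]

variable {z : ℂ} {m : ℤ}

/-- The loss in the first `n` pairs of factors. -/
lemma loss_sum_le (hL0 : 0 ≤ L) (hL : L ≤ 1 / 4) (n : ℕ) (z : ℂ) :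
    Real.exp (-82) * (1 + ‖z‖) ^ (-(4 * L)) ≤ Real.exp (-(∑ j ∈ Finset.range n,
      (L * lossMain ⌊‖z‖⌋₊ (j + 1) + 8 * lossRest ⌊‖z‖⌋₊ (j + 1)))) := by
  have hz := norm_nonneg z
  rw [Real.rpow_def_of_pos (by linarith), ← Real.exp_add, Real.exp_le_exp,
    Finset.sum_add_distrib, ← Finset.mul_sum, ← Finset.mul_sum]
  have h1 := sum_lossMain_le ⌊‖z‖⌋₊ n
  have h2 := sum_lossRest_le ⌊‖z‖⌋₊ n
  have h3 : Real.log ((⌊‖z‖⌋₊ : ℝ) + 1) ≤ Real.log (1 + ‖z‖) :=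
    Real.log_le_log (by positivity) (by linarith [Nat.floor_le hz])
  have h4 := mul_le_mul_of_nonneg_left (h1.trans (by linarith :
    _ ≤ 4 * Real.log (1 + ‖z‖) + 6)) hL0
  linarith

lemma samplingFactor_ge (hL0 : 0 ≤ L) (hL : L ≤ 1 / 4) (ht : ∀ k, |t k - k| ≤ L) (j : ℕ)
    (h1 : 1 / 2 ≤ ‖z - ((j + 1 : ℤ) : ℂ)‖) (h2 : 1 / 2 ≤ ‖z - ((-(j + 1 : ℤ) : ℤ) : ℂ)‖) :
    Real.exp (-(L * lossMain ⌊‖z‖⌋₊ (j + 1) + 8 * lossRest ⌊‖z‖⌋₊ (j + 1)))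
      * ‖1 - z ^ 2 / ((j : ℂ) + 1) ^ 2‖ ≤ ‖samplingFactor t j z‖ := by
  have h := pair_ge_exp_loss (z := z) (k := j + 1) hL0 hL (by lia)
    (by simpa using ht ((j : ℤ) + 1)) (by simpa using ht (-((j : ℤ) + 1)))
    (by rw [norm_sub_rev]; simpa using h1) (by convert h2 using 2; push_cast; ring)
  simpa [samplingFactor] using h

lemma samplingFactor_pole_ge (hL : L ≤ 1 / 4) (ht : ∀ k, |t k - k| ≤ L) (hm0 : m ≠ 0)
    (hz : ∀ k : ℤ, k ≠ m → 1 / 2 ≤ ‖z - k‖) :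
    8 / 25 * ‖z - (t m : ℂ)‖ * ‖1 - z ^ 2 / (((m.natAbs - 1 : ℕ) : ℂ) + 1) ^ 2‖
      ≤ ‖z - m‖ * ‖samplingFactor t (m.natAbs - 1) z‖ := by
  have h := hz (-m) (by lia)
  rcases lt_or_gt_of_ne hm0 with hm | hm
  · have e1 : (((m.natAbs - 1 : ℕ) : ℤ) + 1) = -m := by lia
    have e1c : (((m.natAbs - 1 : ℕ) : ℂ) + 1) = ((-m : ℝ) : ℂ) := by
      have : ((((m.natAbs - 1 : ℕ) : ℤ) + 1 : ℤ) : ℂ) = ((-m : ℤ) : ℂ) := by rw [e1]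
      push_cast at this ⊢; exact this
    unfold samplingFactor
    rw [e1, e1c, neg_neg]
    have hmr : (1 : ℝ) ≤ -m := by
      have : (m : ℝ) ≤ -1 := by exact_mod_cast (by lia : m ≤ -1)
      linarith
    have a1 := ht m
    have a2 := ht (-m)
    push_cast at a2
    have b1 := abs_le.1 a1
    have b2 := abs_le.1 a2
    have n3 : ‖z - ((-m : ℤ) : ℂ)‖ = ‖((-(m : ℝ) : ℝ) : ℂ) + -z‖ := by
      rw [← norm_neg]; congr 1; push_cast; ring
    -- A negative m is reflected to a positive one; the two factors of the pair change places.
    have key := pole_pair_ge (z := -z) (k := -(m : ℝ)) (τ := -t m) (σ := -t (-m)) hL hmr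
      (abs_le.2 ⟨by linarith, by linarith⟩) (abs_le.2 ⟨by linarith, by linarith⟩)
      (n3 ▸ h)
    have n1 : ‖-z - -(t m : ℂ)‖ = ‖z - (t m : ℂ)‖ := by rw [← norm_neg]; congr 1; ring
    have n2 : ‖-z - -(m : ℂ)‖ = ‖z - (m : ℂ)‖ := by rw [← norm_neg]; congr 1; ring
    push_cast at key ⊢
    rw [neg_div_neg_eq, neg_div_neg_eq, neg_sq z, n1, n2] at key
    rw [mul_comm (1 - z / _)]
    exact key
  · have e1 : (((m.natAbs - 1 : ℕ) : ℤ) + 1) = m := by lia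
    have e1c : (((m.natAbs - 1 : ℕ) : ℂ) + 1) = ((m : ℝ) : ℂ) := by
      have : ((((m.natAbs - 1 : ℕ) : ℤ) + 1 : ℤ) : ℂ) = ((m : ℤ) : ℂ) := by rw [e1]
      push_cast at this ⊢; exact this
    unfold samplingFactor
    rw [e1, e1c]
    have hmr : (1 : ℝ) ≤ m := by exact_mod_cast hm
    have a2 := ht (-m)
    push_cast at a2
    have key := pole_pair_ge (z := z) (k := m) hL hmr (ht m) a2
      (by convert h using 2; push_cast; ring)
    exact key

/-- The pairwise bounds are multiplied; n ≥ |m| ensures that the pair containing t_m is present. The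
constant 4/25 is 8/25 from that pair times 1/2 from |z - t_0| ≥ |z|/2. -/
lemma partial_product_ge (hL0 : 0 ≤ L) (hL : L ≤ 1 / 4) (ht : ∀ k, |t k - k| ≤ L)
    (hz : ∀ k : ℤ, k ≠ m → 1 / 2 ≤ ‖z - k‖) {n : ℕ} (hn : m.natAbs ≤ n) :
    4 / 25 * ‖z - (t m : ℂ)‖ *
      ‖z * ∏ j ∈ Finset.range n, ((1 : ℂ) - z ^ 2 / ((j : ℂ) + 1) ^ 2)‖ *
      (Real.exp (-82) * (1 + ‖z‖) ^ (-(4 * L)))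
      ≤ ‖z - m‖ * ‖(z - (t 0 : ℂ)) * ∏ j ∈ Finset.range n, samplingFactor t j z‖ := by
  refine (mul_le_mul_of_nonneg_left (loss_sum_le hL0 hL n z) (by positivity)).trans ?_
  rw [← Finset.sum_neg_distrib, Real.exp_sum, norm_mul, norm_mul, norm_prod, norm_prod]
  set ℓ : ℕ → ℝ := fun j => L * lossMain ⌊‖z‖⌋₊ (j + 1) + 8 * lossRest ⌊‖z‖⌋₊ (j + 1)
  have hℓ : ∀ j, 0 ≤ ℓ j := fun j => by
    have := lossMain_nonneg ⌊‖z‖⌋₊ (j + 1)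
    have := lossRest_nonneg ⌊‖z‖⌋₊ (j + 1)
    positivity
  have hfac : ∀ j : ℕ, j + 1 ≠ m.natAbs →
      Real.exp (-ℓ j) * ‖1 - z ^ 2 / ((j : ℂ) + 1) ^ 2‖ ≤ ‖samplingFactor t j z‖ := fun j hj =>
    samplingFactor_ge hL0 hL ht j (hz _ (by lia)) (hz _ (by lia))
  -- For m = 0 no pair is exceptional: |z - t_0| |z| already occurs on both sides.
  by_cases hm : m = 0
  · subst hm
    have h1 : ∏ j ∈ Finset.range n, (Real.exp (-ℓ j) * ‖1 - z ^ 2 / ((j : ℂ) + 1) ^ 2‖)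
        ≤ ∏ j ∈ Finset.range n, ‖samplingFactor t j z‖ :=
      Finset.prod_le_prod (fun j _ => by positivity) fun j _ => hfac j (by simp)
    rw [Finset.prod_mul_distrib] at h1
    have h2 : 0 ≤ ‖z - (t 0 : ℂ)‖ * ‖z‖ := by positivity
    have h3 := mul_le_mul_of_nonneg_left h1 h2
    have h4 : 0 ≤ ‖z - (t 0 : ℂ)‖ * ‖z‖ * ((∏ j ∈ Finset.range n, Real.exp (-ℓ j)) *
      ∏ j ∈ Finset.range n, ‖1 - z ^ 2 / ((j : ℂ) + 1) ^ 2‖) := by positivity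
    rw [Int.cast_zero, sub_zero]
    nlinarith
  · have h0 : ‖z‖ / 2 ≤ ‖z - (t 0 : ℂ)‖ := by
      have := half_norm_sub_le (k := 0) (τ := t 0) (z := z) hL (by simpa using ht 0)
        (by have := hz 0 (Ne.symm hm); simpa using this)
      rw [norm_sub_rev z]; simpa using this
    have hj0 : m.natAbs - 1 ∈ Finset.range n := Finset.mem_range.2 (by lia)
    rw [← Finset.mul_prod_erase _ (fun j => ‖samplingFactor t j z‖) hj0,
      ← Finset.mul_prod_erase _ (fun j : ℕ => ‖1 - z ^ 2 / ((j : ℂ) + 1) ^ 2‖) hj0,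
      ← Finset.mul_prod_erase _ (fun j => Real.exp (-ℓ j)) hj0]
    have h1 : ∏ j ∈ (Finset.range n).erase (m.natAbs - 1),
          (Real.exp (-ℓ j) * ‖1 - z ^ 2 / ((j : ℂ) + 1) ^ 2‖)
        ≤ ∏ j ∈ (Finset.range n).erase (m.natAbs - 1), ‖samplingFactor t j z‖ :=
      Finset.prod_le_prod (fun j _ => by positivity) fun j hj =>
        hfac j (by have := Finset.ne_of_mem_erase hj; lia)
    rw [Finset.prod_mul_distrib] at h1
    have h2 := samplingFactor_pole_ge hL ht hm hz
    have h3 : Real.exp (-ℓ (m.natAbs - 1)) ≤ 1 := Real.exp_le_one_iff.2 (by linarith [hℓ (m.natAbs - 1)])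
    set S := ‖1 - z ^ 2 / (((m.natAbs - 1 : ℕ) : ℂ) + 1) ^ 2‖
    set P := ∏ j ∈ (Finset.range n).erase (m.natAbs - 1), ‖samplingFactor t j z‖
    set Q := ∏ j ∈ (Finset.range n).erase (m.natAbs - 1), ‖1 - z ^ 2 / ((j : ℂ) + 1) ^ 2‖
    have hQ : 0 ≤ Q := by positivity
    set R := ∏ j ∈ (Finset.range n).erase (m.natAbs - 1), Real.exp (-ℓ j)
    have hR : 0 ≤ R := by positivity
    calc _ = (‖z‖ / 2) * (8 / 25 * ‖z - (t m : ℂ)‖ * S) * (R * Q)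
          * Real.exp (-ℓ (m.natAbs - 1)) := by ring
      _ ≤ ‖z - (t 0 : ℂ)‖ * (‖z - m‖ * ‖samplingFactor t (m.natAbs - 1) z‖) * P * 1 := by gcongr
      _ = _ := by ring

lemma samplingG_ge_sin (hL0 : 0 ≤ L) (hL : L ≤ 1 / 4) (ht : ∀ k, |t k - k| ≤ L)
    (hz : ∀ k : ℤ, k ≠ m → 1 / 2 ≤ ‖z - k‖) :
    4 / 25 * ‖z - (t m : ℂ)‖ * ‖Complex.sin (Real.pi * z)‖ *
      (Real.exp (-82) * (1 + ‖z‖) ^ (-(4 * L))) ≤ Real.pi * (‖z - m‖ * ‖samplingG t z‖) := by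
  have h1 := (Complex.tendsto_euler_sin_prod z).norm
  have h2 := (tendsto_prod_samplingFactor hL ht z).norm
  refine le_of_tendsto_of_tendsto ((h1.const_mul (4 / 25 * ‖z - (t m : ℂ)‖)).mul_const _)
    ((h2.const_mul ‖z - m‖).const_mul Real.pi) ?_
  filter_upwards [eventually_ge_atTop m.natAbs] with n hn
  have h := mul_le_mul_of_nonneg_left (partial_product_ge hL0 hL ht hz hn) Real.pi_pos.le
  refine le_trans (le_of_eq ?_) h
  rw [mul_assoc (Real.pi : ℂ), norm_mul (Real.pi : ℂ), Complex.norm_real, Real.norm_eq_abs,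
    abs_of_pos Real.pi_pos]
  ring

end Product

/-! ### Lower bounds for the sine and for G. -/

/-- From |sin(a + ib)|² = sin² a + sinh² b come two bounds: by |Re w| e^{π|Im w|}, and by half of
e^{π|Im w|} |Im w|/(1 + |Im w|). The factor |w|/(1 + |w|), which records the simple zero at 0, is
dominated by their combination. -/
lemma exp_mul_norm_le_sin {w : ℂ} (hw : |w.re| ≤ 1 / 2) :
    Real.exp (Real.pi * |w.im|) * (‖w‖ / (1 + ‖w‖)) ≤ 4 * ‖Complex.sin (Real.pi * w)‖ := by
  set a := Real.pi * w.re with ha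
  set b := Real.pi * w.im with hb
  have hpi := Real.pi_pos
  have e : (Real.pi : ℂ) * w = (a : ℂ) + (b : ℂ) * Complex.I := by
    apply Complex.ext <;> simp [ha, hb]
  have hsq : ‖Complex.sin (Real.pi * w)‖ ^ 2 = Real.sin a ^ 2 + Real.sinh b ^ 2 := by
    rw [e, Complex.sin_add_mul_I, ← Complex.normSq_eq_norm_sq, ← Complex.ofReal_sin,
      ← Complex.ofReal_cos, ← Complex.ofReal_sinh, ← Complex.ofReal_cosh, ← Complex.ofReal_mul,
      ← Complex.ofReal_mul, Complex.normSq_add_mul_I, mul_pow, mul_pow, Real.cosh_sq,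
      Real.cos_sq']
    ring
  set E := Real.exp (Real.pi * |w.im|) with hE
  have hE0 : 0 < E := Real.exp_pos _
  have hbabs : |b| = Real.pi * |w.im| := by rw [hb, abs_mul, abs_of_pos hpi]
  set y := |w.im| with hy
  have hy0 : 0 ≤ y := abs_nonneg _
  have hcosh : E / 2 ≤ Real.cosh b := by
    rw [← Real.cosh_abs, hbabs, Real.cosh_eq]
    have := Real.exp_pos (-(Real.pi * y))
    linarith
  have hsin : 2 * |w.re| ≤ |Real.sin a| := by
    have h1 : |a| ≤ Real.pi / 2 := by rw [ha, abs_mul, abs_of_pos hpi]; nlinarith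
    have h2 := Real.mul_abs_le_abs_sin h1
    rw [ha, abs_mul, abs_of_pos hpi] at h2
    convert h2 using 1
    field_simp
  have hre : |w.re| * E ≤ ‖Complex.sin (Real.pi * w)‖ := by
    apply le_of_sq_le_sq _ (norm_nonneg _)
    rw [hsq]
    have h3 : Real.sin a ^ 2 + Real.sinh b ^ 2 = Real.sin a ^ 2 * Real.cosh b ^ 2
        + Real.cos a ^ 2 * Real.sinh b ^ 2 := by
      rw [Real.cosh_sq, Real.cos_sq']; ring
    rw [h3]
    have h4 : |w.re| * E ≤ |Real.sin a| * Real.cosh b := by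
      calc |w.re| * E = (2 * |w.re|) * (E / 2) := by ring
        _ ≤ _ := by gcongr
    have h5 : (|w.re| * E) ^ 2 ≤ (|Real.sin a| * Real.cosh b) ^ 2 := by gcongr
    rw [mul_pow |Real.sin a|, sq_abs] at h5
    nlinarith [mul_nonneg (sq_nonneg (Real.cos a)) (sq_nonneg (Real.sinh b))]
  have him : E * (y / (1 + y)) / 2 ≤ ‖Complex.sin (Real.pi * w)‖ := by
    apply le_of_sq_le_sq _ (norm_nonneg _)
    rw [hsq]
    have h6 : E * (y / (1 + y)) / 2 ≤ |Real.sinh b| := by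
      rw [Real.abs_sinh, hbabs, Real.sinh_eq, Real.exp_neg]
      have h7 : 1 + 2 * (Real.pi * y) ≤ E ^ 2 := by
        have := Real.add_one_le_exp (2 * (Real.pi * y))
        rw [hE, ← Real.exp_nat_mul]; push_cast; linarith
      have h8 : E⁻¹ * E ^ 2 = E := by field_simp
      have h9 : y / (1 + y) ≤ 1 - E⁻¹ ^ 2 := by
        have h10 : E⁻¹ ^ 2 ≤ 1 / (1 + 2 * (Real.pi * y)) := by
          rw [inv_pow, ← one_div]
          exact one_div_le_one_div_of_le (by positivity) h7
        have h11 : 1 / (1 + 2 * (Real.pi * y)) ≤ 1 / (1 + y) :=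
          one_div_le_one_div_of_le (by positivity) (by nlinarith [Real.pi_gt_three])
        have h12 : y / (1 + y) = 1 - 1 / (1 + y) := by field_simp; ring
        rw [h12]; linarith
      have h13 := mul_le_mul_of_nonneg_left h9 hE0.le
      have h14 : E * (1 - E⁻¹ ^ 2) = E - E⁻¹ := by field_simp
      rw [h14] at h13
      linarith
    have h5 : (E * (y / (1 + y)) / 2) ^ 2 ≤ |Real.sinh b| ^ 2 := by gcongr
    rw [sq_abs] at h5
    nlinarith [sq_nonneg (Real.sin a)]
  have hn : ‖w‖ ≤ |w.re| + y := Complex.norm_le_abs_re_add_abs_im w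
  have hm : ‖w‖ / (1 + ‖w‖) ≤ 2 * |w.re| + y / (1 + y) := by
    have hmono : ‖w‖ / (1 + ‖w‖) ≤ (|w.re| + y) / (1 + (|w.re| + y)) := by
      rw [div_le_div_iff₀ (by positivity) (by positivity)]; nlinarith
    refine hmono.trans ?_
    rw [add_div]
    have q1 : |w.re| / (1 + (|w.re| + y)) ≤ |w.re| :=
      div_le_self (abs_nonneg _) (by linarith [abs_nonneg w.re])
    have q2 : y / (1 + (|w.re| + y)) ≤ y / (1 + y) := by
      gcongr; linarith [abs_nonneg w.re]
    linarith [abs_nonneg w.re]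
  have := mul_le_mul_of_nonneg_left hm hE0.le
  nlinarith

section LowerBound

variable {t : ℤ → ℝ} {L : ℝ}

lemma half_le_norm_sub_intCast {z : ℂ} {m : ℤ} (hm : |z.re - m| ≤ 1 / 2) (k : ℤ) (hk : k ≠ m) :
    1 / 2 ≤ ‖z - k‖ := by
  have h1 : (1 : ℝ) ≤ |(m : ℝ) - k| := by
    exact_mod_cast Int.one_le_abs (sub_ne_zero.2 (Ne.symm hk))
  have h2 : |(m : ℝ) - k| ≤ |z.re - m| + |z.re - k| := by
    have := abs_sub_le (m : ℝ) z.re k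
    rwa [abs_sub_comm (m : ℝ) z.re] at this
  have h3 : |z.re - k| ≤ ‖z - k‖ := by simpa using Complex.abs_re_le_norm (z - k)
  linarith

/-- The constant in the lower bound for the canonical product. -/
noncomputable def samplingConst : ℝ := Real.exp (-82) / (25 * Real.pi)

lemma samplingConst_pos : 0 < samplingConst :=
  div_pos (Real.exp_pos _) (by linarith [Real.pi_pos])

/-- Periodicity up to sign moves the sine bound to z - m, where its zero cancels the factor |z - m|.
The zero of G at t_m stays visible as |z - t_m|, so the bound also controls G'(t_m). -/
theorem samplingG_ge (hL0 : 0 ≤ L) (hL : L ≤ 1 / 4) (ht : ∀ k, |t k - k| ≤ L) {z : ℂ} {m : ℤ}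
    (hm : |z.re - m| ≤ 1 / 2) :
    samplingConst * ‖z - (t m : ℂ)‖ * Real.exp (Real.pi * |z.im|) * (1 + ‖z‖) ^ (-(4 * L))
      ≤ (1 + ‖z - m‖) * ‖samplingG t z‖ := by
  have main : ∀ z : ℂ, |z.re - m| ≤ 1 / 2 → z ≠ m →
      samplingConst * ‖z - (t m : ℂ)‖ * Real.exp (Real.pi * |z.im|) * (1 + ‖z‖) ^ (-(4 * L))
      ≤ (1 + ‖z - m‖) * ‖samplingG t z‖ := by
    intro z hz hne
    have h1 := samplingG_ge_sin hL0 hL ht (half_le_norm_sub_intCast hz)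
    have h2 := exp_mul_norm_le_sin (w := z - m) (by simpa using hz)
    have h3 : ‖Complex.sin (Real.pi * (z - m))‖ = ‖Complex.sin (Real.pi * z)‖ := by
      have e : (Real.pi : ℂ) * (z - m) = Real.pi * z - m * Real.pi := by ring
      rw [e, Complex.sin_antiperiodic.sub_int_mul_eq m,
        Int.cast_negOnePow, norm_mul, norm_zpow, norm_neg, norm_one,
        one_zpow, one_mul]
    rw [h3] at h2
    have h4 : (z - m).im = z.im := by simp
    rw [h4] at h2
    have hpos : 0 < ‖z - m‖ := norm_pos_iff.2 (sub_ne_zero.2 hne)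
    have hpi := Real.pi_pos
    set X := (1 + ‖z‖) ^ (-(4 * L)) with hX
    have hX0 : 0 < X := Real.rpow_pos_of_pos (by positivity) _
    set E := Real.exp (Real.pi * |z.im|)
    set d := ‖z - m‖
    have h5 : 4 / 25 * ‖z - (t m : ℂ)‖ * (E * (d / (1 + d)) / 4) * (Real.exp (-82) * X)
        ≤ Real.pi * (d * ‖samplingG t z‖) := by
      refine le_trans ?_ h1
      gcongr
      linarith
    have e6 : 4 / 25 * ‖z - (t m : ℂ)‖ * (E * (d / (1 + d)) / 4) * (Real.exp (-82) * X)
        = (Real.pi * d / (1 + d)) * (samplingConst * ‖z - (t m : ℂ)‖ * E * X) := by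
      unfold samplingConst; field_simp
    have e7 : Real.pi * (d * ‖samplingG t z‖)
        = (Real.pi * d / (1 + d)) * ((1 + d) * ‖samplingG t z‖) := by field_simp
    rw [e6, e7] at h5
    exact le_of_mul_le_mul_left h5 (by positivity)
  -- Cancelling |z - m| excluded z = m, where the bound follows by continuity.
  by_cases hzm : z = m
  · subst hzm
    have hG : Continuous (samplingG t) := (differentiable_samplingG hL ht).continuous
    have hx : Continuous fun w : ℂ => (1 + ‖w‖) ^ (-(4 * L)) :=
      (continuous_const.add continuous_norm).rpow_const fun w =>
        Or.inl (by linarith [norm_nonneg w] : 0 < 1 + ‖w‖).ne'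
    have c1 : Continuous fun w : ℂ => samplingConst * ‖w - (t m : ℂ)‖ *
        Real.exp (Real.pi * |w.im|) * (1 + ‖w‖) ^ (-(4 * L)) := by
      refine Continuous.mul ?_ hx
      fun_prop
    have c2 : Continuous fun w : ℂ => (1 + ‖w - m‖) * ‖samplingG t w‖ := by fun_prop
    refine le_of_tendsto_of_tendsto (b := 𝓝[≠] (m : ℂ)) (c1.continuousAt.tendsto.mono_left
      nhdsWithin_le_nhds) (c2.continuousAt.tendsto.mono_left nhdsWithin_le_nhds) ?_
    have c3 : ∀ᶠ w : ℂ in 𝓝 (m : ℂ), |w.re - m| < 1 / 2 := by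
      apply ContinuousAt.eventually_lt (f := fun w : ℂ => |w.re - m|) (by fun_prop)
        continuousAt_const
      simp
    filter_upwards [nhdsWithin_le_nhds c3, self_mem_nhdsWithin] with w hw hw'
    exact main w hw.le hw'
  · exact main z hm hzm

lemma abs_sub_round_re (z : ℂ) : |z.re - round z.re| ≤ 1 / 2 := abs_sub_round z.re

theorem samplingG_eq_zero_iff (hL0 : 0 ≤ L) (hL : L ≤ 1 / 4) (ht : ∀ k, |t k - k| ≤ L) {z : ℂ} :
    samplingG t z = 0 ↔ ∃ m, z = t m := by
  constructor
  · intro h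
    refine ⟨round z.re, ?_⟩
    have h1 := samplingG_ge hL0 hL ht (abs_sub_round_re z)
    rw [h, norm_zero, mul_zero] at h1
    by_contra hne
    have h2 : 0 < ‖z - (t (round z.re) : ℂ)‖ := norm_pos_iff.2 (sub_ne_zero.2 hne)
    have h3 : 0 < (1 + ‖z‖) ^ (-(4 * L)) := Real.rpow_pos_of_pos (by positivity) _
    have := samplingConst_pos
    have : 0 < samplingConst * ‖z - (t (round z.re) : ℂ)‖ * Real.exp (Real.pi * |z.im|)
      * (1 + ‖z‖) ^ (-(4 * L)) := by positivity
    linarith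
  · rintro ⟨m, rfl⟩
    exact samplingG_apply_node hL ht m

/-- Divide `samplingG_ge` by |w - t_m| and let w → t_m. The 1/4 comes from 1 + |t_m - m| ≤ 2 and
from 2^{-4L} ≥ 1/2. -/
theorem norm_deriv_samplingG_ge (hL0 : 0 ≤ L) (hL : L ≤ 1 / 4) (ht : ∀ k, |t k - k| ≤ L) (m : ℤ) :
    samplingConst / 4 * (1 + |(m : ℝ)|) ^ (-(4 * L)) ≤ ‖deriv (samplingG t) (t m : ℂ)‖ := by
  have hd := ((differentiable_samplingG hL ht) (t m : ℂ)).hasDerivAt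
  have hlim := (hasDerivAt_iff_tendsto_slope.1 hd).norm
  have hc := samplingConst_pos
  have htm := abs_le.1 (ht m)
  have c3 : ∀ᶠ w : ℂ in 𝓝 (t m : ℂ), |w.re - m| < 1 / 2 := by
    apply ContinuousAt.eventually_lt (f := fun w : ℂ => |w.re - m|) (by fun_prop)
      continuousAt_const
    simp only [Complex.ofReal_re]
    exact lt_of_le_of_lt (ht m) (by linarith)
  have hx : Continuous fun w : ℂ => (1 + ‖w‖) ^ (-(4 * L)) :=
    (continuous_const.add continuous_norm).rpow_const fun w =>
        Or.inl (by linarith [norm_nonneg w] : 0 < 1 + ‖w‖).ne'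
  have c1 : ContinuousAt (fun w : ℂ => samplingConst * (1 + ‖w‖) ^ (-(4 * L)) / (1 + ‖w - m‖))
      (t m : ℂ) := by
    refine ContinuousAt.div (hx.continuousAt.const_mul _) (by fun_prop) (by positivity)
  have h1 : samplingConst * (1 + ‖(t m : ℂ)‖) ^ (-(4 * L)) / (1 + ‖(t m : ℂ) - m‖)
      ≤ ‖deriv (samplingG t) (t m : ℂ)‖ := by
    refine le_of_tendsto_of_tendsto (c1.tendsto.mono_left nhdsWithin_le_nhds) hlim ?_
    filter_upwards [nhdsWithin_le_nhds c3, self_mem_nhdsWithin] with w hw hw'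
    have hpos : 0 < ‖w - (t m : ℂ)‖ := norm_pos_iff.2 (sub_ne_zero.2 hw')
    have h2 := samplingG_ge hL0 hL ht hw.le
    rw [slope_def_field, samplingG_apply_node hL ht, sub_zero, norm_div,
      div_le_div_iff₀ (by positivity) hpos]
    have h3 : (1 : ℝ) ≤ Real.exp (Real.pi * |w.im|) :=
      Real.one_le_exp (by have := Real.pi_pos; positivity)
    have h4 : 0 < (1 + ‖w‖) ^ (-(4 * L)) := Real.rpow_pos_of_pos (by positivity) _
    have h5 : 0 ≤ samplingConst * ‖w - (t m : ℂ)‖ * (1 + ‖w‖) ^ (-(4 * L)) := by positivity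
    nlinarith
  refine le_trans ?_ h1
  have e1 : ‖(t m : ℂ) - m‖ ≤ 1 := by
    have : (t m : ℂ) - m = ((t m - m : ℝ) : ℂ) := by push_cast; rfl
    rw [this, Complex.norm_real, Real.norm_eq_abs]
    linarith [ht m]
  have e2 : ‖(t m : ℂ)‖ ≤ |(m : ℝ)| + 1 := by
    rw [Complex.norm_real, Real.norm_eq_abs]
    have := abs_sub_abs_le_abs_sub (t m) m
    linarith [ht m]
  have e3 : (2 : ℝ)⁻¹ * (1 + |(m : ℝ)|) ^ (-(4 * L)) ≤ (1 + ‖(t m : ℂ)‖) ^ (-(4 * L)) := by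
    calc (2 : ℝ)⁻¹ * (1 + |(m : ℝ)|) ^ (-(4 * L))
        ≤ 2 ^ (-(4 * L)) * (1 + |(m : ℝ)|) ^ (-(4 * L)) := by
          gcongr
          rw [← Real.rpow_neg_one]
          exact Real.rpow_le_rpow_of_exponent_le (by norm_num) (by linarith)
      _ = (2 * (1 + |(m : ℝ)|)) ^ (-(4 * L)) := by
          rw [Real.mul_rpow (by norm_num) (by positivity)]
      _ ≤ _ := Real.rpow_le_rpow_of_nonpos (by positivity) (by linarith [abs_nonneg (m : ℝ)])
          (by linarith)
  rw [le_div_iff₀ (by positivity)]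
  have h6 : 0 ≤ (1 + |(m : ℝ)|) ^ (-(4 * L)) := by positivity
  calc samplingConst / 4 * (1 + |(m : ℝ)|) ^ (-(4 * L)) * (1 + ‖(t m : ℂ) - m‖)
      ≤ samplingConst / 4 * (1 + |(m : ℝ)|) ^ (-(4 * L)) * (1 + 1) := by gcongr
    _ = samplingConst * ((2 : ℝ)⁻¹ * (1 + |(m : ℝ)|) ^ (-(4 * L))) := by ring
    _ ≤ _ := by gcongr

theorem deriv_samplingG_ne_zero (hL0 : 0 ≤ L) (hL : L ≤ 1 / 4) (ht : ∀ k, |t k - k| ≤ L) (m : ℤ) :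
    deriv (samplingG t) (t m : ℂ) ≠ 0 := by
  have h := norm_deriv_samplingG_ge hL0 hL ht m
  have h1 : 0 < (1 + |(m : ℝ)|) ^ (-(4 * L)) := Real.rpow_pos_of_pos (by positivity) _
  have := samplingConst_pos
  exact norm_pos_iff.1 (lt_of_lt_of_le (by positivity) h)

/-- On this circle the distance d to every integer is at least 1/2, so |z - t_m| ≥ d/2 and 1 + d ≤
3d; hence the factor 1/6. -/
theorem samplingG_ge_of_norm_eq (hL0 : 0 ≤ L) (hL : L ≤ 1 / 4) (ht : ∀ k, |t k - k| ≤ L) {z : ℂ}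
    {N : ℕ} (hz : ‖z‖ = N + 1 / 2) :
    samplingConst / 6 * Real.exp (Real.pi * |z.im|) * (1 + ‖z‖) ^ (-(4 * L))
      ≤ ‖samplingG t z‖ := by
  set m := round z.re
  have h1 := samplingG_ge hL0 hL ht (abs_sub_round_re z)
  have h2 : 1 / 2 ≤ ‖(m : ℂ) - z‖ := by
    have h3 := abs_norm_sub_norm_le (m : ℂ) z
    refine le_trans ?_ h3
    have e : ‖(m : ℂ)‖ = (m.natAbs : ℝ) := by
      rw [Complex.norm_intCast, Nat.cast_natAbs, Int.cast_abs]
    rw [e, hz]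
    rcases le_or_gt m.natAbs N with h | h
    · have : (m.natAbs : ℝ) ≤ N := by exact_mod_cast h
      rw [abs_of_nonpos] <;> linarith
    · have : (N : ℝ) + 1 ≤ m.natAbs := by exact_mod_cast h
      rw [abs_of_nonneg] <;> linarith
  have h4 := half_norm_sub_le (k := m) (z := z) hL (ht m) (by exact_mod_cast h2)
  push_cast at h4
  rw [norm_sub_rev z, norm_sub_rev z] at h1
  have hc := samplingConst_pos
  set d := ‖(m : ℂ) - z‖
  have hd : 0 < d := by linarith
  set X := (1 + ‖z‖) ^ (-(4 * L))
  have hX : 0 < X := Real.rpow_pos_of_pos (by positivity) _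
  have h5 : samplingConst * (d / 2) * Real.exp (Real.pi * |z.im|) * X
      ≤ 3 * d * ‖samplingG t z‖ := by
    refine le_trans ?_ (h1.trans ?_)
    · gcongr
    · gcongr; linarith
  have h6 : 3 * d * (samplingConst / 6 * Real.exp (Real.pi * |z.im|) * X)
      ≤ 3 * d * ‖samplingG t z‖ := by
    refine le_trans (le_of_eq ?_) h5; ring
  exact le_of_mul_le_mul_left h6 (by positivity)

end LowerBound

/-! ### Interpolation by contour integration -/

/-- The quotient of two entire functions, with removable singularities at simple zeros of the
denominator removed. -/
noncomputable def entireQuotient (Q G : ℂ → ℂ) (z : ℂ) : ℂ :=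
  if G z = 0 then deriv Q z / deriv G z else Q z / G z

lemma entireQuotient_eventuallyEq {Q G : ℂ → ℂ} (hG : Continuous G) {z : ℂ} (hz : G z ≠ 0) :
    entireQuotient Q G =ᶠ[𝓝 z] fun w => Q w / G w := by
  filter_upwards [hG.continuousAt.eventually_ne hz] with w hw
  simp [entireQuotient, hw]

/-- At a simple zero of G, Q/G is the quotient of the two slope functions, which are continuous
there, with nonzero denominator. -/
lemma continuousAt_entireQuotient {Q G : ℂ → ℂ} (hQ : Differentiable ℂ Q) (hG : Differentiable ℂ G)
    {z : ℂ} (hz : G z = 0 → Q z = 0 ∧ deriv G z ≠ 0) : ContinuousAt (entireQuotient Q G) z := by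
  by_cases h0 : G z = 0
  · obtain ⟨hQz, hdG⟩ := hz h0
    have cQ : ContinuousAt (dslope Q z) z := continuousAt_dslope_same.2 (hQ z)
    have cG : ContinuousAt (dslope G z) z := continuousAt_dslope_same.2 (hG z)
    have hne : dslope G z z ≠ 0 := by rwa [dslope_same]
    refine (cQ.div cG hne).congr ?_
    filter_upwards [cG.eventually_ne hne] with w hw
    by_cases hwz : w = z
    · subst hwz
      simp [entireQuotient, h0]
    · have h1 : w - z ≠ 0 := sub_ne_zero.2 hwz
      rw [Pi.div_apply, dslope_of_ne _ hwz, dslope_of_ne _ hwz, slope_def_field, slope_def_field,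
        hQz, h0, sub_zero, sub_zero, div_div_div_cancel_right₀ h1]
      rw [dslope_of_ne _ hwz, slope_def_field, h0, sub_zero] at hw
      have : G w ≠ 0 := by rintro h; simp [h] at hw
      simp [entireQuotient, this]
  · exact ((hQ.continuous.continuousAt).div (hG.continuous.continuousAt) h0).congr
      (entireQuotient_eventuallyEq hG.continuous h0).symm

lemma circleIntegral_inv_mul_inv_eq_zero {R : ℝ} {a b : ℂ} (ha : a ∈ Metric.ball (0 : ℂ) R)
    (hb : b ∈ Metric.ball (0 : ℂ) R) (hab : a ≠ b) :
    (∮ z in C(0, R), (z - a)⁻¹ * (z - b)⁻¹) = 0 := by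
  have hR : 0 < R := Metric.pos_of_mem_ball ha
  have hne : ∀ c ∈ Metric.ball (0 : ℂ) R, ∀ z ∈ Metric.sphere (0 : ℂ) R, z - c ≠ 0 := by
    intro c hc z hz h
    rw [sub_eq_zero] at h
    rw [h] at hz
    rw [Metric.mem_ball] at hc
    rw [Metric.mem_sphere] at hz
    linarith
  have hint : ∀ c ∈ Metric.ball (0 : ℂ) R, CircleIntegrable (fun z => (z - c)⁻¹) 0 R := fun c hc =>
    ContinuousOn.circleIntegrable hR.le
      (ContinuousOn.inv₀ (by fun_prop) (hne c hc))
  have h1 : (∮ z in C(0, R), (z - a)⁻¹ * (z - b)⁻¹)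
      = ∮ z in C(0, R), (a - b)⁻¹ * ((z - a)⁻¹ - (z - b)⁻¹) := by
    refine circleIntegral.integral_congr hR.le fun z hz => ?_
    have := hne a ha z hz
    have := hne b hb z hz
    have : a - b ≠ 0 := sub_ne_zero.2 hab
    field_simp
    ring
  rw [h1, circleIntegral.integral_const_mul, circleIntegral.integral_sub (hint a ha) (hint b hb),
    circleIntegral.integral_sub_inv_of_mem_ball ha, circleIntegral.integral_sub_inv_of_mem_ball hb,
    sub_self, mul_zero]

/-- Partial fractions for `P / G` in a disc, with remainder an integral over the boundary. -/
theorem partial_fraction_eq_circleIntegral {P G : ℂ → ℂ} (hP : Differentiable ℂ P)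
    (hG : Differentiable ℂ G) {R : ℝ} {ι : Type*} [DecidableEq ι] (s : Finset ι) (a : ι → ℂ)
    (hinj : Set.InjOn a s) (ha : ∀ i ∈ s, a i ∈ Metric.ball (0 : ℂ) R)
    (hzero : ∀ z ∈ Metric.closedBall (0 : ℂ) R, G z = 0 ↔ ∃ i ∈ s, z = a i)
    (hderiv : ∀ i ∈ s, deriv G (a i) ≠ 0) {w : ℂ} (hw : w ∈ Metric.ball (0 : ℂ) R)
    (hGw : G w ≠ 0) :
    (∮ z in C(0, R), (z - w)⁻¹ * (P z / G z)) = 2 * Real.pi * Complex.I *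
      (P w / G w - ∑ i ∈ s, P (a i) / deriv G (a i) / (w - a i)) := by
  have hR : 0 < R := Metric.pos_of_mem_ball hw
  have hGa : ∀ i ∈ s, G (a i) = 0 := fun i hi =>
    (hzero _ (Metric.ball_subset_closedBall (ha i hi))).2 ⟨i, hi, rfl⟩
  set c : ι → ℂ := fun i => P (a i) / deriv G (a i) with hc
  -- At the nodes, `dslope G (a i)` is G'(a_i) at a_i and 0 at the others, so Q vanishes at all of
  -- them, and Q/G is P/G with its principal parts removed.
  set Q : ℂ → ℂ := fun z => P z - ∑ i ∈ s, c i * dslope G (a i) z with hQdef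
  have hds : ∀ i, Differentiable ℂ (dslope G (a i)) := fun i => by
    rw [← differentiableOn_univ]
    exact (Complex.differentiableOn_dslope univ_mem).2 hG.differentiableOn
  have hQ : Differentiable ℂ Q := by
    refine hP.sub (Differentiable.fun_sum fun i _ => (hds i).const_mul _)
  have hQa : ∀ i ∈ s, Q (a i) = 0 := by
    intro i hi
    simp only [hQdef]
    rw [Finset.sum_eq_single_of_mem i hi]
    · rw [dslope_same, hc]; simp only; rw [div_mul_cancel₀ _ (hderiv i hi), sub_self]
    · intro j hj hji
      have hne : a i ≠ a j := fun h => hji (hinj hj hi h.symm)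
      rw [dslope_of_ne _ hne, slope_def_field, hGa i hi, hGa j hj]
      simp
  have hQeq : ∀ z, G z ≠ 0 → Q z / G z = P z / G z - ∑ i ∈ s, c i / (z - a i) := by
    intro z hz
    simp only [hQdef]
    rw [sub_div, Finset.sum_div]
    congr 1
    refine Finset.sum_congr rfl fun i hi => ?_
    have hne : z ≠ a i := by rintro rfl; exact hz (hGa i hi)
    have := sub_ne_zero.2 hne
    rw [dslope_of_ne _ hne, slope_def_field, hGa i hi]
    field_simp
    simp
  have hcont : ContinuousOn (entireQuotient Q G) (Metric.closedBall 0 R) := by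
    intro z hz
    refine (continuousAt_entireQuotient hQ hG fun h => ?_).continuousWithinAt
    obtain ⟨i, hi, rfl⟩ := (hzero z hz).1 h
    exact ⟨hQa i hi, hderiv i hi⟩
  have hdiff : ∀ z ∈ Metric.ball (0 : ℂ) R \ (a '' s), DifferentiableAt ℂ (entireQuotient Q G) z := by
    rintro z ⟨hz, hzs⟩
    have hz0 : G z ≠ 0 := by
      intro h
      obtain ⟨i, hi, rfl⟩ := (hzero z (Metric.ball_subset_closedBall hz)).1 h
      exact hzs ⟨i, hi, rfl⟩
    exact ((hQ z).div (hG z) hz0).congr_of_eventuallyEq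
      (entireQuotient_eventuallyEq hG.continuous hz0)
  -- This form of Cauchy's formula needs only continuity at the nodes.
  have key := Complex.circleIntegral_sub_inv_smul_of_differentiable_on_off_countable
    (s.countable_toSet.image a) hw hcont hdiff
  have hbd : ∀ z ∈ Metric.sphere (0 : ℂ) R, G z ≠ 0 := by
    intro z hz h
    obtain ⟨i, hi, rfl⟩ := (hzero z (Metric.sphere_subset_closedBall hz)).1 h
    have := ha i hi
    rw [Metric.mem_ball] at this
    rw [Metric.mem_sphere] at hz
    linarith
  have hne : ∀ c ∈ Metric.ball (0 : ℂ) R, ∀ z ∈ Metric.sphere (0 : ℂ) R, z - c ≠ 0 := by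
    intro c hc z hz h
    rw [sub_eq_zero] at h
    rw [h] at hz
    rw [Metric.mem_ball] at hc
    rw [Metric.mem_sphere] at hz
    linarith
  have hI : (∮ z in C(0, R), (z - w)⁻¹ • entireQuotient Q G z)
      = ∮ z in C(0, R), ((z - w)⁻¹ * (P z / G z) - ∑ i ∈ s, c i * ((z - w)⁻¹ * (z - a i)⁻¹)) := by
    refine circleIntegral.integral_congr hR.le fun z hz => ?_
    simp only [entireQuotient, smul_eq_mul]
    rw [if_neg (hbd z hz), hQeq z (hbd z hz), mul_sub, Finset.mul_sum]
    congr 1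
    refine Finset.sum_congr rfl fun i _ => ?_
    rw [div_eq_mul_inv]; ring
  have hcw : ContinuousOn (fun z : ℂ => (z - w)⁻¹) (Metric.sphere 0 R) :=
    ContinuousOn.inv₀ (by fun_prop) (hne w hw)
  have i1 : CircleIntegrable (fun z => (z - w)⁻¹ * (P z / G z)) 0 R :=
    ContinuousOn.circleIntegrable hR.le
      (hcw.mul (hP.continuous.continuousOn.div hG.continuous.continuousOn hbd))
  have i2 : ∀ i ∈ s, CircleIntegrable (fun z => c i * ((z - w)⁻¹ * (z - a i)⁻¹)) 0 R := fun i hi =>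
    ContinuousOn.circleIntegrable hR.le (continuousOn_const.mul
      (hcw.mul (ContinuousOn.inv₀ (by fun_prop) (hne (a i) (ha i hi)))))
  have i3 : (∮ z in C(0, R), ∑ i ∈ s, c i * ((z - w)⁻¹ * (z - a i)⁻¹)) = 0 := by
    rw [circleIntegral.integral_fun_sum i2]
    refine Finset.sum_eq_zero fun i hi => ?_
    rw [circleIntegral.integral_const_mul, circleIntegral_inv_mul_inv_eq_zero hw (ha i hi)
      (by rintro rfl; exact hGw (hGa i hi)), mul_zero]
  rw [hI, circleIntegral.integral_sub i1 (CircleIntegrable.fun_sum s i2), i3, sub_zero] at key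
  rw [key]
  simp only [entireQuotient, smul_eq_mul]
  rw [if_neg hGw, hQeq w hGw]

section Interpolation

variable {t : ℤ → ℝ} {L C : ℝ} {P : ℂ → ℂ}

lemma injective_nodes (hL : L < 1 / 4) (ht : ∀ k, |t k - k| ≤ L) : Function.Injective t := by
  intro j k hjk
  by_contra hne
  have h1 : (1 : ℝ) ≤ |(j : ℝ) - k| := by
    exact_mod_cast Int.one_le_abs (sub_ne_zero.2 hne)
  have h2 : |(j : ℝ) - k| ≤ |t j - j| + |t k - k| := by
    have := abs_sub_le (j : ℝ) (t j) k
    rw [abs_sub_comm (j : ℝ) (t j), hjk] at this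
    rwa [hjk]
  linarith [ht j, ht k]

lemma three_fourths_mul_abs_le (hL : L ≤ 1 / 4) (ht : ∀ k, |t k - k| ≤ L) {k : ℤ} (hk : k ≠ 0) :
    3 / 4 * |(k : ℝ)| ≤ |t k| := by
  have h1 : (1 : ℝ) ≤ |(k : ℝ)| := by exact_mod_cast Int.one_le_abs hk
  have h2 := abs_sub_abs_le_abs_sub (k : ℝ) (t k)
  rw [abs_sub_comm] at h2
  linarith [ht k]

/-- The coefficients `P(t_k) / G'(t_k)` of an interpolation series are `O(|k|^{4L-1})`. -/
lemma norm_coeff_le (hL0 : 0 ≤ L) (hL : L < 1 / 4) (ht : ∀ k, |t k - k| ≤ L)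
    (hP : ∀ z, ‖z‖ * ‖P z‖ ≤ C * Real.exp (Real.pi * |z.im|)) {k : ℤ} (hk : k ≠ 0) :
    ‖P (t k)‖ / ‖deriv (samplingG t) (t k : ℂ)‖
      ≤ 16 * C / samplingConst * |(k : ℝ)| ^ (4 * L - 1) := by
  have h1 : (1 : ℝ) ≤ |(k : ℝ)| := by exact_mod_cast Int.one_le_abs hk
  have hk0 : 0 < |(k : ℝ)| := by linarith
  have h2 := three_fourths_mul_abs_le hL.le ht hk
  have h3 := hP (t k)
  simp only [Complex.norm_real, Real.norm_eq_abs, Complex.ofReal_im, abs_zero, mul_zero,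
    Real.exp_zero, mul_one] at h3
  have h4 := norm_deriv_samplingG_ge hL0 hL.le ht k
  have hc := samplingConst_pos
  have hP1 : ‖P (t k)‖ ≤ 2 * C / |(k : ℝ)| := by
    rw [le_div_iff₀ hk0]
    nlinarith [norm_nonneg (P (t k))]
  have hC : 0 ≤ C := le_trans (by positivity) h3
  have h5 : samplingConst / 8 * |(k : ℝ)| ^ (-(4 * L)) ≤ ‖deriv (samplingG t) (t k : ℂ)‖ := by
    refine le_trans ?_ h4
    have e3 : (2 : ℝ)⁻¹ * |(k : ℝ)| ^ (-(4 * L)) ≤ (1 + |(k : ℝ)|) ^ (-(4 * L)) := by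
      calc (2 : ℝ)⁻¹ * |(k : ℝ)| ^ (-(4 * L))
          ≤ 2 ^ (-(4 * L)) * |(k : ℝ)| ^ (-(4 * L)) := by
            gcongr
            rw [← Real.rpow_neg_one]
            exact Real.rpow_le_rpow_of_exponent_le (by norm_num) (by linarith)
        _ = (2 * |(k : ℝ)|) ^ (-(4 * L)) := by
            rw [Real.mul_rpow (by norm_num) (by positivity)]
        _ ≤ _ := Real.rpow_le_rpow_of_nonpos (by positivity) (by linarith) (by linarith)
    nlinarith
  have hx : 0 < |(k : ℝ)| ^ (-(4 * L)) := Real.rpow_pos_of_pos hk0 _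
  calc ‖P (t k)‖ / ‖deriv (samplingG t) (t k : ℂ)‖
      ≤ (2 * C / |(k : ℝ)|) / (samplingConst / 8 * |(k : ℝ)| ^ (-(4 * L))) := by gcongr
    _ = 16 * C / samplingConst * (|(k : ℝ)| ^ (4 * L) / |(k : ℝ)|) := by
        rw [Real.rpow_neg hk0.le]; field_simp; ring
    _ = _ := by rw [← Real.rpow_sub_one hk0.ne']

lemma samplingKernel_of_ne {k : ℤ} {s : ℝ} (h : s ≠ t k) :
    samplingKernel t k s
      = samplingG t s / (deriv (samplingG t) (t k : ℂ) * ((s : ℂ) - (t k : ℂ))) := if_neg h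

/-- The coefficient is O(|k|^{4L-1}) and 1/|s - t_k| is O(1/|k|) on K, so the exponent 4L - 2 is
below -1. Finitely many k, whose nodes may lie in or near K, are left out. -/
lemma exists_summable_bound (hL0 : 0 ≤ L) (hL : L < 1 / 4) (ht : ∀ k, |t k - k| ≤ L)
    (hP : ∀ z, ‖z‖ * ‖P z‖ ≤ C * Real.exp (Real.pi * |z.im|)) {K : Set ℝ} (hK : IsCompact K) :
    ∃ u : ℤ → ℝ, Summable u ∧ ∀ᶠ k in cofinite, ∀ s ∈ K,
      ‖P (t k) * samplingKernel t k s‖ ≤ u k := by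
  obtain ⟨B, hB⟩ := hK.isBounded.exists_norm_le
  have hG : Continuous fun s : ℝ => samplingG t (s : ℂ) :=
    (differentiable_samplingG hL.le ht).continuous.comp Complex.continuous_ofReal
  obtain ⟨M, hM⟩ := hK.exists_bound_of_continuousOn hG.continuousOn
  refine ⟨fun k => M * (16 * C / samplingConst) * 2 * |(k : ℝ)| ^ (-(2 - 4 * L)),
    (Real.summable_abs_int_rpow (by linarith)).mul_left _, ?_⟩
  -- With |k| > 4B, |t_k| - |s| ≥ 3|k|/4 - |k|/4 = |k|/2.
  have hfin : {k : ℤ | ¬ (4 * B < |(k : ℝ)| ∧ k ≠ 0)}.Finite := by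
    refine (Set.finite_Icc (-⌈4 * |B|⌉) ⌈4 * |B|⌉).subset fun k hk => ?_
    have hb : |(k : ℝ)| ≤ 4 * |B| := by
      by_contra h
      exact hk ⟨by linarith [le_abs_self B], by
        rintro rfl
        simp only [Int.cast_zero, abs_zero, not_le] at h
        linarith [abs_nonneg B]⟩
    have h1 := abs_le.1 (hb.trans (Int.le_ceil _))
    exact ⟨by exact_mod_cast h1.1, by exact_mod_cast h1.2⟩
  filter_upwards [hfin.compl_mem_cofinite] with k hk s hs
  simp only [mem_compl_iff, mem_ofPred_eq, not_not] at hk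
  obtain ⟨hk1, hk0⟩ := hk
  have hkpos : 0 < |(k : ℝ)| := abs_pos.2 (by exact_mod_cast hk0)
  have h2 := three_fourths_mul_abs_le hL.le ht hk0
  have hsB := hB s hs
  rw [Real.norm_eq_abs] at hsB
  have hdist : |(k : ℝ)| / 2 ≤ |s - t k| := by
    have := abs_sub_abs_le_abs_sub (t k) s
    rw [abs_sub_comm] at this
    linarith
  have hne : s ≠ t k := by
    rintro h
    rw [h, sub_self, abs_zero] at hdist
    linarith
  have hd : ‖(s : ℂ) - (t k : ℂ)‖ = |s - t k| := by
    rw [← Complex.ofReal_sub, Complex.norm_real, Real.norm_eq_abs]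
  have hcoef := norm_coeff_le hL0 hL ht hP hk0
  rw [samplingKernel_of_ne hne, norm_mul, norm_div, norm_mul, hd]
  have hM0 : 0 ≤ M := (norm_nonneg _).trans (hM s hs)
  have hx : 0 ≤ |(k : ℝ)| ^ (4 * L - 1) := by positivity
  calc ‖P (t k)‖ * (‖samplingG t s‖ / (‖deriv (samplingG t) (t k : ℂ)‖ * |s - t k|))
      = ‖samplingG t s‖ * (‖P (t k)‖ / ‖deriv (samplingG t) (t k : ℂ)‖) * (1 / |s - t k|) := by
        rw [div_mul_eq_div_div]; ring
    _ ≤ M * (16 * C / samplingConst * |(k : ℝ)| ^ (4 * L - 1)) * (1 / (|(k : ℝ)| / 2)) := by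
        gcongr
        · exact mul_nonneg hM0 (le_trans (by positivity) hcoef)
        · exact hM s hs
    _ = M * (16 * C / samplingConst) * 2 * (|(k : ℝ)| ^ (4 * L - 1) / |(k : ℝ)|) := by
        field_simp
    _ = _ := by
        rw [← Real.rpow_sub_one hkpos.ne']; congr 2; ring

/-- On |z| = R = N + 1/2 the exponentials of P and G cancel, leaving P/G = O(R^{4L-1}); the factor
1/(z - s) compensates the length of the circle. -/
lemma tendsto_symmetric_sum (hL0 : 0 ≤ L) (hL : L < 1 / 4) (ht : ∀ k, |t k - k| ≤ L)
    (hPd : Differentiable ℂ P)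
    (hP : ∀ z, ‖z‖ * ‖P z‖ ≤ C * Real.exp (Real.pi * |z.im|)) {s : ℝ} (hs : ∀ k, s ≠ t k) :
    Tendsto (fun N : ℕ => ∑ k ∈ Finset.Icc (-(N : ℤ)) N, P (t k) * samplingKernel t k s) atTop
      (𝓝 (P s)) := by
  have hG := differentiable_samplingG hL.le ht
  have hinj := injective_nodes hL ht
  have hc := samplingConst_pos
  have hC : 0 ≤ C := by
    have := hP 0
    simpa using this
  have hGs : samplingG t s ≠ 0 := by
    rw [Ne, samplingG_eq_zero_iff hL0 hL.le ht]
    rintro ⟨k, hk⟩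
    exact hs k (by exact_mod_cast hk)
  set D : ℕ → ℂ := fun N => P s / samplingG t s - ∑ k ∈ Finset.Icc (-(N : ℤ)) N,
    P (t k) / deriv (samplingG t) (t k : ℂ) / ((s : ℂ) - (t k : ℂ)) with hD
  have hbound : ∀ N : ℕ, 2 * |s| ≤ N → 1 ≤ N →
      ‖D N‖ ≤ 20 * C / samplingConst * (1 + ((N : ℝ) + 1 / 2)) ^ (-(1 - 4 * L)) := by
    intro N hN hN1
    set R : ℝ := (N : ℝ) + 1 / 2 with hR
    have hN1' : (1 : ℝ) ≤ N := by exact_mod_cast hN1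
    have hR0 : 0 < R := by linarith
    -- Nodes move by at most 1/4, so none crosses the circle halfway between consecutive integers.
    have htN : ∀ k : ℤ, |t k| ≤ R ↔ k ∈ Finset.Icc (-(N : ℤ)) N := by
      intro k
      rw [Finset.mem_Icc, ← abs_le]
      have h1 := abs_sub_abs_le_abs_sub (t k) k
      have h2 := abs_sub_abs_le_abs_sub (k : ℝ) (t k)
      rw [abs_sub_comm (k : ℝ)] at h2
      have h3 := ht k
      constructor
      · intro h
        have : (|k| : ℝ) < (N : ℝ) + 1 := by linarith
        have : |k| < (N : ℤ) + 1 := by exact_mod_cast this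
        lia
      · intro h
        have : (|k| : ℝ) ≤ N := by exact_mod_cast h
        linarith
    have hmem : ∀ k ∈ Finset.Icc (-(N : ℤ)) N, (t k : ℂ) ∈ Metric.ball (0 : ℂ) R := by
      intro k hk
      rw [mem_ball_zero_iff, Complex.norm_real, Real.norm_eq_abs]
      have h1 := abs_sub_abs_le_abs_sub (t k) k
      rw [Finset.mem_Icc, ← abs_le] at hk
      have : (|k| : ℝ) ≤ N := by exact_mod_cast hk
      linarith [ht k]
    have key := partial_fraction_eq_circleIntegral hPd hG (R := R) (Finset.Icc (-(N : ℤ)) N)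
      (fun k => (t k : ℂ)) (fun i _ j _ h => hinj (Complex.ofReal_injective h)) hmem ?_
      (fun k _ => deriv_samplingG_ne_zero hL0 hL.le ht k) (w := s) ?_ hGs
    rotate_left
    · intro z hz
      rw [samplingG_eq_zero_iff hL0 hL.le ht]
      constructor
      · rintro ⟨k, rfl⟩
        rw [mem_closedBall_zero_iff, Complex.norm_real, Real.norm_eq_abs] at hz
        exact ⟨k, (htN k).1 hz, rfl⟩
      · rintro ⟨k, _, rfl⟩
        exact ⟨k, rfl⟩
    · rw [mem_ball_zero_iff, Complex.norm_real, Real.norm_eq_abs]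
      linarith [abs_nonneg s]
    set X := (1 + R) ^ (-(4 * L)) with hX
    have hX0 : 0 < X := Real.rpow_pos_of_pos (by positivity) _
    have hest : ∀ z ∈ Metric.sphere (0 : ℂ) R, ‖(z - (s : ℂ))⁻¹ * (P z / samplingG t z)‖
        ≤ (R / 2)⁻¹ * (6 * C / samplingConst / (R * X)) := by
      intro z hz
      rw [mem_sphere_zero_iff_norm] at hz
      have h1 := samplingG_ge_of_norm_eq hL0 hL.le ht (hz.trans hR)
      have h2 := hP z
      rw [hz] at h1 h2
      have h3 : R / 2 ≤ ‖z - (s : ℂ)‖ := by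
        have := norm_sub_norm_le z (s : ℂ)
        rw [hz, Complex.norm_real, Real.norm_eq_abs] at this
        linarith
      have hE := Real.exp_pos (Real.pi * |z.im|)
      set E := Real.exp (Real.pi * |z.im|)
      rw [norm_mul, norm_inv, norm_div]
      refine mul_le_mul (inv_anti₀ (by positivity) h3) ?_ (by positivity) (by positivity)
      have hP1 : ‖P z‖ ≤ C * E / R := by rw [le_div_iff₀ hR0]; linarith
      calc ‖P z‖ / ‖samplingG t z‖ ≤ (C * E / R) / (samplingConst / 6 * E * X) := by gcongr
        _ = _ := by field_simp
    have hI := circleIntegral.norm_integral_le_of_norm_le_const hR0.le hest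
    rw [key, norm_mul] at hI
    have hpi := Real.pi_pos
    have h2pi : ‖(2 * Real.pi * Complex.I : ℂ)‖ = 2 * Real.pi := by
      simp [abs_of_pos hpi]
    rw [h2pi, mul_assoc (2 * Real.pi) R] at hI
    have hI2 := le_of_mul_le_mul_left hI (by positivity)
    refine hI2.trans ?_
    have e1 : R * ((R / 2)⁻¹ * (6 * C / samplingConst / (R * X)))
        = 12 * C / samplingConst * (1 / X) * (1 / R) := by field_simp; ring
    have e2 : (1 + R) ^ (-(1 - 4 * L)) = 1 / X * (1 / (1 + R)) := by
      rw [hX, Real.rpow_neg (by positivity) (4 * L), one_div, inv_inv, neg_sub,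
        Real.rpow_sub_one (by positivity)]
      ring
    have h5 : 1 / R ≤ 5 / 3 * (1 / (1 + R)) := by
      rw [div_le_iff₀ hR0]
      have : 5 / 3 * (1 / (1 + R)) * R = (5 / 3) * (R / (1 + R)) := by ring
      rw [this]
      have : (3 / 5 : ℝ) ≤ R / (1 + R) := by rw [le_div_iff₀ (by positivity)]; linarith
      linarith
    rw [e1, e2]
    have h6 : 0 ≤ C / samplingConst * (1 / X) := by positivity
    have h7 : 0 ≤ 1 / (1 + R) := by positivity
    calc 12 * C / samplingConst * (1 / X) * (1 / R)
        = 12 * (C / samplingConst * (1 / X)) * (1 / R) := by ring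
      _ ≤ 12 * (C / samplingConst * (1 / X)) * (5 / 3 * (1 / (1 + R))) := by gcongr
      _ = 20 * (C / samplingConst * (1 / X)) * (1 / (1 + R)) := by ring
      _ = _ := by ring
  have hDlim : Tendsto D atTop (𝓝 0) := by
    have h1 : Tendsto (fun N : ℕ => 20 * C / samplingConst *
        (1 + ((N : ℝ) + 1 / 2)) ^ (-(1 - 4 * L))) atTop (𝓝 (20 * C / samplingConst * 0)) := by
      refine Tendsto.const_mul _ ((tendsto_rpow_neg_atTop (by linarith)).comp ?_)
      exact tendsto_atTop_add_const_left _ _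
        (tendsto_atTop_add_const_right _ _ tendsto_natCast_atTop_atTop)
    rw [mul_zero] at h1
    refine squeeze_zero_norm' ?_ h1
    filter_upwards [eventually_ge_atTop ⌈2 * |s|⌉₊, eventually_ge_atTop 1] with N hN hN1
    exact hbound N (Nat.ceil_le.1 hN) hN1
  have h2 := (hDlim.const_mul (samplingG t s)).const_sub (P s)
  rw [mul_zero, sub_zero] at h2
  refine h2.congr fun N => ?_
  simp only [hD]
  rw [mul_sub, mul_div_cancel₀ _ hGs, sub_sub_cancel, Finset.mul_sum]
  refine Finset.sum_congr rfl fun k _ => ?_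
  rw [samplingKernel_of_ne (hs k)]
  rw [div_mul_eq_div_div]
  ring

/-- Interpolation at nodes with `sup |t_k - k| < 1 / 4` of an entire function of exponential type
`π` which is `O(1 / |x|)` on the real line. -/
theorem hasSumUniformlyOn_samplingKernel (hL0 : 0 ≤ L) (hL : L < 1 / 4)
    (ht : ∀ k, |t k - k| ≤ L) (hPd : Differentiable ℂ P)
    (hP : ∀ z, ‖z‖ * ‖P z‖ ≤ C * Real.exp (Real.pi * |z.im|)) {K : Set ℝ} (hK : IsCompact K) :
    HasSumUniformlyOn (fun (k : ℤ) (s : ℝ) => P (t k) * samplingKernel t k s)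
      (fun s => P s) K := by
  obtain ⟨u, hu, hub⟩ := exists_summable_bound hL0 hL ht hP hK
  have h := HasSumUniformlyOn.of_norm_le_summable_eventually hu hub
  refine h.congr_right fun s hs => ?_
  simp only
  by_cases hst : ∃ m, s = t m
  · obtain ⟨m, rfl⟩ := hst
    rw [tsum_eq_single m]
    · simp [samplingKernel]
    · intro k hk
      have hne : t m ≠ t k := fun h => hk (injective_nodes hL ht h).symm
      rw [samplingKernel_of_ne hne, samplingG_apply_node hL.le ht]
      simp
  · push Not at hst
    -- The sum exists unconditionally, so symmetric partial sums suffice to identify it.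
    have h1 : Tendsto (fun N : ℕ => ∑ k ∈ Finset.Icc (-(N : ℤ)) N,
        P (t k) * samplingKernel t k s) atTop
        (𝓝 (∑' k : ℤ, P (t k) * samplingKernel t k s)) := by
      have h2 := h.hasSum hs
      rw [HasSum, SummationFilter.unconditional_filter] at h2
      exact h2.comp (Finset.tendsto_Icc_neg (R := ℤ))
    exact tendsto_nhds_unique h1 (tendsto_symmetric_sum hL0 hL ht hPd hP hst)

end Interpolation

/-! ### Entire extension of functions with exponentially bounded derivatives -/

section Taylor

variable {φ : ℕ → ℝ → ℂ} {σ M : ℝ}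

/-- The Taylor polynomial of `φ 0` at `x`, evaluated at the complex point `u`. -/
noncomputable def taylorPartial (φ : ℕ → ℝ → ℂ) (u : ℂ) (n : ℕ) (x : ℝ) : ℂ :=
  ∑ k ∈ Finset.range n, φ k x * ((u - x) ^ k / (k.factorial : ℂ))

/-- Differentiating in the centre telescopes: each term cancels part of the next, and only the last
survives. -/
lemma hasDerivAt_taylorPartial (hφ : ∀ k x, HasDerivAt (φ k) (φ (k + 1) x) x) (u : ℂ) (n : ℕ)
    (x : ℝ) : HasDerivAt (taylorPartial φ u (n + 1))
      (φ (n + 1) x * ((u - x) ^ n / (n.factorial : ℂ))) x := by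
  induction n with
  | zero =>
    have h : taylorPartial φ u (0 + 1) = φ 0 := by
      ext y; simp [taylorPartial]
    rw [h]
    simpa using hφ 0 x
  | succ n ih =>
    have h : taylorPartial φ u (n + 1 + 1) = fun y => taylorPartial φ u (n + 1) y
        + φ (n + 1) y * ((u - y) ^ (n + 1) / ((n + 1).factorial : ℂ)) := by
      ext y; simp [taylorPartial, Finset.sum_range_succ]
    rw [h]
    have h1 : HasDerivAt (fun y : ℝ => (u - (y : ℂ))) (-1) x := by
      simpa using (Complex.ofRealCLM.hasDerivAt (x := x)).const_sub u
    have h2 := (h1.fun_pow (n + 1)).div_const ((n + 1).factorial : ℂ)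
    have h3 := ih.add ((hφ (n + 1) x).mul h2)
    refine h3.congr_deriv ?_
    have hn : (n.factorial : ℂ) ≠ 0 := by exact_mod_cast n.factorial_ne_zero
    have hn1 : (n : ℂ) + 1 ≠ 0 := by exact_mod_cast n.succ_ne_zero
    rw [Nat.factorial_succ]
    push_cast
    field_simp
    ring

lemma norm_taylor_term_le (hφb : ∀ k x, ‖φ k x‖ ≤ σ ^ k * M) {w : ℂ}
    {B : ℝ} (hw : ‖w‖ ≤ B) (k : ℕ) (x : ℝ) :
    ‖φ k x * (w ^ k / (k.factorial : ℂ))‖ ≤ M * ((σ * B) ^ k / k.factorial) := by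
  rw [norm_mul, norm_div, norm_pow, Complex.norm_natCast, mul_pow]
  have h := hφb k x
  calc ‖φ k x‖ * (‖w‖ ^ k / k.factorial) ≤ (σ ^ k * M) * (B ^ k / k.factorial) := by
        gcongr
        exact (norm_nonneg _).trans h
    _ = _ := by ring

lemma summable_taylor (hφb : ∀ k x, ‖φ k x‖ ≤ σ ^ k * M) (w : ℂ) (x : ℝ) :
    Summable fun k => φ k x * (w ^ k / (k.factorial : ℂ)) :=
  Summable.of_norm_bounded ((Real.summable_pow_div_factorial (σ * ‖w‖)).mul_left M)
    fun k => norm_taylor_term_le hφb le_rfl k x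

/-- The Taylor series does not depend on its centre: by the mean value inequality, moving the centre
changes a partial sum by O((σB)^n/n!). -/
lemma tsum_taylor_eq (hφ : ∀ k x, HasDerivAt (φ k) (φ (k + 1) x) x)
    (hφb : ∀ k x, ‖φ k x‖ ≤ σ ^ k * M) (u : ℂ) (X : ℝ) :
    ∑' k, φ k X * ((u - X) ^ k / (k.factorial : ℂ)) = ∑' k, φ k 0 * (u ^ k / (k.factorial : ℂ)) := by
  set B := ‖u‖ + |X| with hB
  have hM : 0 ≤ M := by simpa using (norm_nonneg _).trans (hφb 0 0)
  have hbound : ∀ n, ‖taylorPartial φ u (n + 1) X - taylorPartial φ u (n + 1) 0‖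
      ≤ σ * M * ((σ * B) ^ n / n.factorial) * ‖X - 0‖ := by
    intro n
    refine (convex_uIcc (0 : ℝ) X).norm_image_sub_le_of_norm_hasDerivWithin_le
      (fun y _ => (hasDerivAt_taylorPartial hφ u n y).hasDerivWithinAt) (fun y hy => ?_)
      left_mem_uIcc right_mem_uIcc
    have hy1 : ‖u - y‖ ≤ B := by
      refine (norm_sub_le _ _).trans ?_
      have : |y| ≤ |X| := by
        have := abs_sub_left_of_mem_uIcc hy
        simpa using this
      rw [Complex.norm_real, Real.norm_eq_abs]
      linarith
    have := norm_taylor_term_le (φ := fun k => φ (k + 1)) (M := σ * M) (σ := σ)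
      (fun k x => (hφb (k + 1) x).trans_eq (by ring)) hy1 n y
    exact this
  have hlim : ∀ x : ℝ, Tendsto (fun n => taylorPartial φ u (n + 1) x) atTop
      (𝓝 (∑' k, φ k x * ((u - x) ^ k / (k.factorial : ℂ)))) := fun x =>
    ((summable_taylor hφb (u - x) x).hasSum.tendsto_sum_nat).comp (tendsto_add_atTop_nat 1)
  have h0 : Tendsto (fun n : ℕ => σ * M * ((σ * B) ^ n / n.factorial) * ‖X - 0‖) atTop (𝓝 0) := by
    have := ((FloorSemiring.tendsto_pow_div_factorial_atTop (σ * B)).const_mul (σ * M)).mul_const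
      ‖X - 0‖
    simpa using this
  have h1 := squeeze_zero_norm hbound h0
  have h2 := tendsto_nhds_unique h1 ((hlim X).sub (hlim 0))
  rw [eq_comm, sub_eq_zero] at h2
  simpa using h2

/-- A function on the real line whose `k`-th derivative is bounded by `σ ^ k M` extends to an entire
function of exponential type `σ`. -/
theorem exists_entire_extension (hφ : ∀ k x, HasDerivAt (φ k) (φ (k + 1) x) x)
    (hφb : ∀ k x, ‖φ k x‖ ≤ σ ^ k * M) :
    ∃ E : ℂ → ℂ, Differentiable ℂ E ∧ (∀ x : ℝ, E x = φ 0 x) ∧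
      ∀ z, ‖E z‖ ≤ M * Real.exp (σ * |z.im|) := by
  refine ⟨fun z => ∑' k, φ k 0 * (z ^ k / (k.factorial : ℂ)), ?_, ?_, ?_⟩
  · intro z
    have h := Complex.differentiableOn_tsum_of_summable_norm
      (F := fun k z => φ k 0 * (z ^ k / (k.factorial : ℂ))) (U := Metric.ball 0 (‖z‖ + 1))
      ((Real.summable_pow_div_factorial (σ * (‖z‖ + 1))).mul_left M)
      (fun k => by fun_prop) Metric.isOpen_ball
      (fun k w hw => norm_taylor_term_le hφb (mem_ball_zero_iff.1 hw).le k 0)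
    exact h.differentiableAt (Metric.isOpen_ball.mem_nhds (by simp))
  · intro x
    simp only
    rw [← tsum_taylor_eq hφ hφb x x, tsum_eq_single 0]
    · simp
    · intro k hk
      simp [hk]
  · intro z
    simp only
    -- Centred at Re z, the series has increment i Im z, so only |Im z| enters the exponential
    -- bound.
    rw [← tsum_taylor_eq hφ hφb z z.re]
    have hexp : HasSum (fun k : ℕ => M * ((σ * |z.im|) ^ k / k.factorial))
        (M * Real.exp (σ * |z.im|)) := by
      rw [Real.exp_eq_exp_ℝ]
      exact (NormedSpace.expSeries_div_hasSum_exp (σ * |z.im|)).mul_left M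
    refine tsum_of_norm_bounded hexp fun k => norm_taylor_term_le hφb ?_ k _
    have : z - z.re = z.im * Complex.I := by
      apply Complex.ext <;> simp
    rw [this]
    simp

end Taylor

/-! ### Mellin translations and the duality pairing -/

section Pairing

variable {p q : ℝ} {a b g : ℝ → ℂ}

lemma map_mul_left_restrict_Ioi {c : ℝ} (hc : 0 < c) :
    Measure.map (c * ·) (volume.restrict (Ioi (0 : ℝ)))
      = ENNReal.ofReal c⁻¹ • volume.restrict (Ioi (0 : ℝ)) := by
  have h := (measurableEmbedding_mulLeft₀ hc.ne').restrict_map volume (Ioi (0 : ℝ))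
  have h2 : (c * ·) ⁻¹' (Ioi (0 : ℝ)) = Ioi 0 := by
    ext x; simp [hc]
  rw [h2, Real.map_volume_mul_left hc.ne', Measure.restrict_smul, abs_of_pos (inv_pos.2 hc)] at h
  exact h.symm

lemma mellinTranslate_mul_ae (p s : ℝ) (a : ℝ → ℂ) :
    (fun x : ℝ => mellinTranslate s a x * ((x ^ (-1 / p) : ℝ) : ℂ))
      =ᵐ[volume.restrict (Ioi (0 : ℝ))] (((Real.exp s) ^ (1 / p) : ℝ) : ℂ) •
        ((fun x : ℝ => a x * ((x ^ (-1 / p) : ℝ) : ℂ)) ∘ (Real.exp s * ·)) := by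
  filter_upwards [ae_restrict_mem measurableSet_Ioi] with x hx
  have hx' : (0 : ℝ) < x := hx
  have hc := Real.exp_pos s
  simp only [mellinTranslate, Pi.smul_apply, Function.comp_apply, smul_eq_mul]
  rw [Real.mul_rpow hc.le hx'.le, mul_left_comm, ← Complex.ofReal_mul, ← mul_assoc,
    ← Real.rpow_add hc]
  have : 1 / p + -1 / p = 0 := by ring
  rw [this, Real.rpow_zero, one_mul]

/-- The weight x^{-1/p} turns the norm into an L^p norm for dx/x, which is invariant under
dilations. -/
lemma mellinXNorm_mellinTranslate (hp : 0 < p) (s : ℝ) (a : ℝ → ℂ) :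
    mellinXNorm p (mellinTranslate s a) = mellinXNorm p a := by
  have hc := Real.exp_pos s
  unfold mellinXNorm
  rw [eLpNorm_congr_ae (mellinTranslate_mul_ae p s a), eLpNorm_const_smul,
    ← (measurableEmbedding_mulLeft₀ hc.ne').eLpNorm_map_measure, map_mul_left_restrict_Ioi hc,
    eLpNorm_smul_measure_of_ne_top ENNReal.ofReal_ne_top, smul_eq_mul, ← mul_assoc]
  have h1 : (1 / ENNReal.ofReal p).toReal = 1 / p := by
    rw [ENNReal.toReal_div, ENNReal.toReal_ofReal hp.le]; simp
  rw [h1, ENNReal.ofReal_rpow_of_pos (inv_pos.2 hc), Real.inv_rpow hc.le, ← ofReal_norm,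
    Complex.norm_real, Real.norm_eq_abs, abs_of_pos (Real.rpow_pos_of_pos hc _),
    ← ENNReal.ofReal_mul (Real.rpow_pos_of_pos hc _).le,
    mul_inv_cancel₀ (Real.rpow_pos_of_pos hc _).ne', ENNReal.ofReal_one, one_mul]

lemma MemMellinX.mellinTranslate (hp : 0 < p) (ha : MemMellinX p a) (s : ℝ) :
    MemMellinX p (mellinTranslate s a) := by
  have hc := Real.exp_pos s
  refine ⟨?_, ?_⟩
  · refine AEStronglyMeasurable.congr ?_ (mellinTranslate_mul_ae p s a).symm
    refine AEStronglyMeasurable.const_smul ?_ _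
    rw [← (measurableEmbedding_mulLeft₀ hc.ne').aestronglyMeasurable_map_iff,
      map_mul_left_restrict_Ioi hc]
    exact ha.1.smul_measure _
  · have := mellinXNorm_mellinTranslate hp s a
    unfold mellinXNorm at this
    rw [this]
    exact ha.2

/-- The density 1/x splits as x^{-1/p} x^{-1/q}, one weight for each space, which is the form
Hölder's inequality needs. -/
lemma mul_div_ae (hpq : 1 / p + 1 / q = 1) (a g : ℝ → ℂ) :
    (fun x : ℝ => a x * g x / (x : ℂ)) =ᵐ[volume.restrict (Ioi (0 : ℝ))]
      (fun x : ℝ => a x * ((x ^ (-1 / p) : ℝ) : ℂ)) • (fun x => g x * ((x ^ (-1 / q) : ℝ) : ℂ)) := by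
  filter_upwards [ae_restrict_mem measurableSet_Ioi] with x hx
  have hx' : (0 : ℝ) < x := hx
  simp only [Pi.smul_apply', smul_eq_mul]
  have h : (x : ℂ)⁻¹ = ((x ^ (-1 / p) : ℝ) : ℂ) * ((x ^ (-1 / q) : ℝ) : ℂ) := by
    rw [← Complex.ofReal_mul, ← Real.rpow_add hx']
    have : -1 / p + -1 / q = -1 := by linear_combination -hpq
    rw [this, Real.rpow_neg_one, Complex.ofReal_inv]
  rw [div_eq_mul_inv, h]
  ring

lemma holderTriple_ofReal (hp : 1 < p) (hpq : 1 / p + 1 / q = 1) :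
    ENNReal.HolderTriple (ENNReal.ofReal p) (ENNReal.ofReal q) 1 :=
  (Real.holderConjugate_iff.2 ⟨hp, by simpa using hpq⟩ : p.HolderConjugate q).ennrealOfReal

lemma MemMellinX.integrableOn_mul (hp : 1 < p) (hpq : 1 / p + 1 / q = 1) (ha : MemMellinX p a)
    (hg : MemMellinX q g) : IntegrableOn (fun x : ℝ => a x * g x / (x : ℂ)) (Ioi (0 : ℝ)) := by
  have := holderTriple_ofReal hp hpq
  exact (memLp_one_iff_integrable.1 (hg.smul ha)).congr (mul_div_ae hpq a g).symm

lemma MemMellinX.enorm_integral_mul_le (hp : 1 < p) (hpq : 1 / p + 1 / q = 1)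
    (ha : MemMellinX p a) (hg : MemMellinX q g) :
    ‖∫ x in Ioi (0 : ℝ), a x * g x / (x : ℂ)‖ₑ ≤ mellinXNorm p a * mellinXNorm q g := by
  have := holderTriple_ofReal hp hpq
  refine (enorm_integral_le_lintegral_enorm _).trans ?_
  rw [← eLpNorm_one_eq_lintegral_enorm, eLpNorm_congr_ae (mul_div_ae hpq a g)]
  exact eLpNorm_smul_le_mul_eLpNorm hg.1 ha.1

lemma MemMellinX.norm_mellinPhi_le (hp : 1 < p) (hpq : 1 / p + 1 / q = 1)
    (ha : MemMellinX p a) (hg : MemMellinX q g) (s : ℝ) :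
    ‖mellinPhi a g s‖ ≤ (mellinXNorm p a * mellinXNorm q g).toReal := by
  have h := (ha.mellinTranslate (by linarith) s).enorm_integral_mul_le hp hpq hg
  rw [mellinXNorm_mellinTranslate (by linarith)] at h
  rw [← toReal_enorm]
  exact ENNReal.toReal_mono (ENNReal.mul_ne_top ha.2.ne hg.2.ne) h

lemma MemMellinX.sub (ha : MemMellinX p a) (hb : MemMellinX p b) :
    MemMellinX p (fun x => a x - b x) := by
  have := MemLp.sub ha hb
  unfold MemMellinX
  convert this using 2 with x
  simp only [Pi.sub_apply]; ring

lemma MemMellinX.div_const (ha : MemMellinX p a) (c : ℂ) :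
    MemMellinX p (fun x => a x / c) := by
  have := MemLp.const_mul ha c⁻¹
  unfold MemMellinX
  convert this using 2 with x
  rw [div_eq_mul_inv]; ring

/-- The pairing is differentiable, with the generator applied to the first argument. -/
theorem IsMellinTheta.hasDerivAt_mellinPhi (hp : 1 < p) (hpq : 1 / p + 1 / q = 1)
    (hab : IsMellinTheta p a b) (hg : MemMellinX q g) (s : ℝ) :
    HasDerivAt (mellinPhi a g) (mellinPhi b g s) s := by
  obtain ⟨ha, hb, hlim⟩ := hab
  have hp0 : 0 < p := by linarith
  rw [hasDerivAt_iff_tendsto_slope_zero, tendsto_iff_norm_sub_tendsto_zero]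
  set W : ℝ → ℝ → ℂ := fun h x => (mellinTranslate h a x - a x) / (h : ℂ) - b x with hW
  have hWm : ∀ h, MemMellinX p (W h) := fun h =>
    (((ha.mellinTranslate hp0 h).sub ha).div_const _).sub hb
  have hN : Tendsto (fun h => (mellinXNorm p (W h) * mellinXNorm q g).toReal) (𝓝[≠] 0) (𝓝 0) := by
    have h1 := ENNReal.Tendsto.mul_const (b := mellinXNorm q g) hlim (Or.inr hg.2.ne)
    rw [zero_mul] at h1
    exact (ENNReal.tendsto_toReal ENNReal.zero_ne_top).comp h1
  refine squeeze_zero' (Eventually.of_forall fun _ => norm_nonneg _) ?_ hN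
  filter_upwards [self_mem_nhdsWithin] with h hh
  have hh0 : (h : ℂ) ≠ 0 := by exact_mod_cast hh
  -- By the group law the error at s is the pairing of U(s)W_h with g, and U(s) is isometric, so
  -- convergence at s = 0 in norm suffices.
  have key : h⁻¹ • (mellinPhi a g (s + h) - mellinPhi a g s) - mellinPhi b g s
      = mellinPhi (W h) g s := by
    have i1 := (ha.mellinTranslate hp0 (s + h)).integrableOn_mul hp hpq hg
    have i2 := (ha.mellinTranslate hp0 s).integrableOn_mul hp hpq hg
    have i3 := (hb.mellinTranslate hp0 s).integrableOn_mul hp hpq hg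
    unfold mellinPhi
    rw [← integral_sub i1 i2, ← integral_smul]
    refine (integral_sub ((i1.sub i2).smul h⁻¹) i3).symm.trans ?_
    refine integral_congr_ae (Eventually.of_forall fun x => ?_)
    have e : Real.exp (s + h) * x = Real.exp h * (Real.exp s * x) := by rw [Real.exp_add]; ring
    simp only [hW, mellinTranslate, Pi.smul_apply, Pi.sub_apply, Complex.real_smul,
      Complex.ofReal_inv, e]
    ring
  rw [key]
  exact (hWm h).norm_mellinPhi_le hp hpq hg s

/-- Membership in the domain of the (k+1)-st power rules out the default value 0 of `mellinTheta`.
-/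
lemma MemMellinBernstein.isMellinTheta {σ : ℝ} {f : ℝ → ℂ} (hf : MemMellinBernstein p σ f) (k : ℕ) :
    IsMellinTheta p ((mellinTheta p)^[k] f) ((mellinTheta p)^[k + 1] f) := by
  have h := (hf.1 (k + 1)).2 k (Nat.lt_succ_self k)
  rw [Function.iterate_succ_apply', mellinTheta, dif_pos h]
  exact h.choose_spec

lemma mellinTranslate_zero (a : ℝ → ℂ) : mellinTranslate 0 a = a := by
  ext x; simp [mellinTranslate]

lemma mellinPsi_of_ne (hp : 1 < p) (hpq : 1 / p + 1 / q = 1) (ha : MemMellinX p a)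
    (hg : MemMellinX q g) {s : ℝ} (hs : s ≠ 0) :
    mellinPsi p a g s = (mellinPhi a g s - mellinPhi a g 0) / s := by
  have i1 := (ha.mellinTranslate (by linarith) s).integrableOn_mul hp hpq hg
  have i2 := (ha.mellinTranslate (by linarith) 0).integrableOn_mul hp hpq hg
  rw [mellinPsi, if_neg hs]
  unfold mellinPhi
  rw [← integral_sub i1 i2, ← integral_div]
  refine integral_congr_ae (Eventually.of_forall fun x => ?_)
  simp only [mellinTranslate_zero]
  ring

end Pairing

/-! ### The sampling theorem -/

/-- For `f` in the Bernstein space, `Ψ` is the restriction to the real line of an entire function of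
exponential type `σ` that is `O(1 / |x|)` on the real line. -/
theorem MemMellinBernstein.exists_entire_mellinPsi {p q σ : ℝ} {f g : ℝ → ℂ} (hp : 1 < p)
    (hpq : 1 / p + 1 / q = 1) (hσ : 0 ≤ σ) (hf : MemMellinBernstein p σ f) (hg : MemMellinX q g) :
    ∃ (P : ℂ → ℂ) (C : ℝ), Differentiable ℂ P ∧ (∀ s : ℝ, P s = mellinPsi p f g s) ∧
      ∀ z, ‖z‖ * ‖P z‖ ≤ C * Real.exp (σ * |z.im|) := by
  have hfX : MemMellinX p f := (hf.1 0).1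
  set M := (mellinXNorm p f * mellinXNorm q g).toReal with hM
  have hb : ∀ k x, ‖mellinPhi ((mellinTheta p)^[k] f) g x‖ ≤ σ ^ k * M := by
    intro k x
    refine ((hf.isMellinTheta k).1.norm_mellinPhi_le hp hpq hg x).trans ?_
    have h1 : (ENNReal.ofReal (σ ^ k) * (mellinXNorm p f * mellinXNorm q g)).toReal
        = σ ^ k * M := by
      rw [ENNReal.toReal_mul, ENNReal.toReal_ofReal (by positivity)]
    rw [← h1, ← mul_assoc]
    refine ENNReal.toReal_mono ?_ (mul_le_mul_left (hf.2 k) _)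
    exact ENNReal.mul_ne_top (ENNReal.mul_ne_top ENNReal.ofReal_ne_top hfX.2.ne) hg.2.ne
  have hd : ∀ k x, HasDerivAt (mellinPhi ((mellinTheta p)^[k] f) g)
      (mellinPhi ((mellinTheta p)^[k + 1] f) g x) x := fun k x =>
    (hf.isMellinTheta k).hasDerivAt_mellinPhi hp hpq hg x
  obtain ⟨E, hE, hEx, hEb⟩ := exists_entire_extension hd hb
  have hEx' : ∀ x : ℝ, E x = mellinPhi f g x := hEx
  have hMn : 0 ≤ M := ENNReal.toReal_nonneg
  -- The constant 2M bounds E(z) - E(0) = z P(z), one M for each term.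
  refine ⟨dslope E 0, 2 * M, ?_, ?_, ?_⟩
  · rw [← differentiableOn_univ]
    exact (Complex.differentiableOn_dslope univ_mem).2 hE.differentiableOn
  · intro s
    by_cases hs : s = 0
    · subst hs
      rw [Complex.ofReal_zero, dslope_same]
      have h1 : HasDerivAt (fun x : ℝ => E x) (deriv E 0) 0 := by
        have := (hE 0).hasDerivAt
        exact HasDerivAt.comp_ofReal (z := 0) (by simpa using this)
      have h2 : (fun x : ℝ => E x) = mellinPhi f g := funext hEx'
      rw [h2] at h1
      rw [h1.unique (hd 0 0), mellinPsi, if_pos rfl]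
      simp only [mellinPhi, mellinTranslate_zero]
      rfl
    · have hs' : (s : ℂ) ≠ 0 := by exact_mod_cast hs
      rw [dslope_of_ne _ hs', slope_def_field, mellinPsi_of_ne hp hpq hfX hg hs, sub_zero, hEx',
        ← hEx' 0, Complex.ofReal_zero]
  · intro z
    have h0 : ‖E 0‖ ≤ M * Real.exp (σ * |z.im|) := by
      refine (hEb 0).trans ?_
      rw [Complex.zero_im, abs_zero]
      gcongr
      exact abs_nonneg _
    by_cases hz : z = 0
    · subst hz
      simp only [norm_zero, zero_mul]
      positivity
    · rw [dslope_of_ne _ hz, slope_def_field, sub_zero, norm_div,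
        mul_div_cancel₀ _ (norm_ne_zero_iff.2 hz)]
      refine (norm_sub_le _ _).trans ?_
      linarith [hEb z]

lemma HasSumUniformlyOn.mul_left_of_isCompact {ι : Type*} {F : ι → ℝ → ℂ} {S : ℝ → ℂ} {K : Set ℝ}
    (hK : IsCompact K) (h : HasSumUniformlyOn F S K) :
    HasSumUniformlyOn (fun i (s : ℝ) => (s : ℂ) * F i s)
      (fun s : ℝ => (s : ℂ) * S s) K := by
  rw [hasSumUniformlyOn_iff_tendstoUniformlyOn, Metric.tendstoUniformlyOn_iff] at h ⊢
  obtain ⟨B, hB⟩ := hK.isBounded.exists_norm_le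
  intro ε hε
  have hB0 : 0 < |B| + 1 := by positivity
  filter_upwards [h (ε / (|B| + 1)) (by positivity)] with I hI s hs
  have h1 := hI s hs
  rw [← Finset.mul_sum, dist_eq_norm, ← mul_sub, norm_mul, Complex.norm_real]
  rw [dist_eq_norm, lt_div_iff₀ hB0] at h1
  have h2 : ‖s‖ ≤ |B| + 1 := (hB s hs).trans (by linarith [le_abs_self B])
  have := mul_le_mul_of_nonneg_right h2 (norm_nonneg (S s - ∑ i ∈ I, F i s))
  linarith

/-- Boundedness is a separate hypothesis because the real supremum of an unbounded family is 0 by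
convention. The second series is s times the first, as s Ψ(s) = Φ(s) - Φ(0). -/
theorem mainTheorem8 (t : ℤ → ℝ)
    (ht_bdd : BddAbove (Set.range fun k : ℤ => |t k - (k : ℝ)|))
    (ht : ⨆ k : ℤ, |t k - (k : ℝ)| < 1 / 4) :
    (HasProdLocallyUniformlyOn (samplingFactor t) (fun z => ∏' n : ℕ, samplingFactor t n z)
        Set.univ ∧
      Differentiable ℂ (samplingG t) ∧
      ∀ k : ℤ, deriv (samplingG t) (t k : ℂ) ≠ 0) ∧
    ∀ (p q : ℝ), 1 < p → 1 / p + 1 / q = 1 →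
      ∀ f g : ℝ → ℂ, MemMellinBernstein p Real.pi f → MemMellinX q g →
        (∀ s : ℝ, IntegrableOn (fun x : ℝ => mellinTranslate s f x * g x / (x : ℂ))
          (Set.Ioi (0 : ℝ))) ∧
        IntegrableOn (fun x : ℝ => mellinTheta p f x * g x / (x : ℂ)) (Set.Ioi (0 : ℝ)) ∧
        ∀ K : Set ℝ, IsCompact K →
          HasSumUniformlyOn (fun (k : ℤ) (s : ℝ) => mellinPsi p f g (t k) * samplingKernel t k s)
            (mellinPsi p f g) K ∧
          HasSumUniformlyOn
            (fun (k : ℤ) (s : ℝ) => (s : ℂ) * (mellinPsi p f g (t k) * samplingKernel t k s))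
            (fun s => mellinPhi f g s - mellinPhi f g 0) K := by
  have hle : ∀ k : ℤ, |t k - k| ≤ ⨆ k : ℤ, |t k - (k : ℝ)| := fun k => le_ciSup ht_bdd k
  set L := ⨆ k : ℤ, |t k - (k : ℝ)|
  have hL0 : 0 ≤ L := (abs_nonneg _).trans (hle 0)
  refine ⟨⟨hasProdLocallyUniformlyOn_samplingFactor ht.le hle, differentiable_samplingG ht.le hle,
    deriv_samplingG_ne_zero hL0 ht.le hle⟩, ?_⟩
  intro p q hp hpq f g hf hg
  have hfX : MemMellinX p f := (hf.1 0).1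
  refine ⟨fun s => (hfX.mellinTranslate (by linarith) s).integrableOn_mul hp hpq hg,
    (hf.isMellinTheta 0).2.1.integrableOn_mul hp hpq hg, fun K hK => ?_⟩
  obtain ⟨P, C, hPd, hPs, hPb⟩ := hf.exists_entire_mellinPsi hp hpq Real.pi_pos.le hg
  have h := hasSumUniformlyOn_samplingKernel hL0 ht hle hPd hPb hK
  simp only [hPs] at h
  refine ⟨h, (h.mul_left_of_isCompact hK).congr_right fun s _ => ?_⟩
  simp only
  by_cases hs : s = 0
  · simp [hs]
  · have hs' : (s : ℂ) ≠ 0 := by exact_mod_cast hs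
    rw [mellinPsi_of_ne hp hpq hfX hg hs, mul_div_cancel₀ _ hs']
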